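/- \textbf{Setting.} Let $n,s\ge 1$ and let $N\to\infty$ along multiples of $n$. All finite-$N$ assumptions are required for all large such $N$. \emph{Weights.} Let $x_1>0$ be fixed and let $x_{1,N}=x_1>x_{2,N}>\dots>x_{n,N}>0$, extended to $x_{1,N},\dots,x_{N,N}$ with period $n$. Let $I_2\subset\{1,\dots,n\}$, $r=|I_2|$, and $y_l>0$ for $l\in I_2$. Let $\sigma_0\in\Sigma_N$ satisfy $x_{\sigma_0(1),N}\ge\dots\ge x_{\sigma_0(N),N}$. \emph{Boundary.} Let $\lambda(N)=(\lambda_1\ge\dots\ge\lambda_N\ge0)$ be integers such that $\{\lambda_j+N+1-j:1\le j\le N\}=\bigcup_{t=1}^s\{A_t,A_t+1,\dots,B_t\}$ with $A_1\le B_1<A_2\le B_2<\dots<A_s\le B_s$ depending on $N$, where $A_t/N\to a_t$, $B_t/N\to b_t$ and $a_1<b_1<a_2<\dots<a_s<b_s$. Let $\mu_1>\dots>\mu_s$ be the distinct values of the $\lambda_j$, and let $J_i$ be the set of $t$ such that $\lambda_p=\mu_t$ for some $p$ with $\sigma_0(p)\equiv i \pmod n$. Assume $\ell<t$ whenever $\ell\in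 J_i$, $t\in J_j$, $i<j$. \emph{Limit measures.} For $1\le i\le n$ let $\phi^{(i)}(N)$ be the partition whose parts are the numbers $\lambda_j+|\{k>j:\ x_{\sigma_0(k),N}\ne x_{\sigma_0(j),N}\}|$ over all $j$ with $x_{\sigma_0(j),N}=x_{i,N}$. For a partition $\phi$ with $M$ parts put $m(\phi)=\frac1M\sum_{j=1}^M\delta_{(\phi_j+M-j)/M}$. Let $\mathbf m_i$ be the weak limit of $m(\phi^{(i)}(N))$. \emph{The equation.} Let $\mathrm{St}_{\mathbf m_i}(t)=\int\frac{\mathbf m_i(dx)}{t-x}$. For a value $t$ of $\mathrm{St}_{\mathbf m_i}^{(-1)}(\log z)$ (principal logarithm; there may be several values), let $H'_{\mathbf m_i}(z)=\frac1z\bigl(t-\frac{1}{\log z}\bigr)+\frac1{z\log z}-\frac1{z-1}$. This is the derivative of $H_{\mathbf m_i}(u)=\int_0^{\log u}R_{\mathbf m_i}+\log\frac{\log u}{u-1}$, with $R_{\mathbf m_i}$ the Voiculescu $R$-transform, on the corresponding branch. Let $$A_i(z)=\mathbf 1_{i=1}\,\frac{\kappa}{n}\sum_{l\in I_2}\frac{y_lx_1}{1+y_lx_1z}-\frac{\kappa}{n}\frac{n-i}{z}+\frac1nH'_{\mathbf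 m_i}(z),\qquad F_{i,\kappa}(z)=\frac1n\frac{z}{z-1}+\frac{1}{1-\kappa}\,zA_i(z).$$ A non-real $z$ is a root of $F_{i,\kappa}(z)=\frac{\chi}{1-\kappa}$ if the equation holds for some value $t$ of $\mathrm{St}_{\mathbf m_i}^{(-1)}(\log z)$; the equation then determines $t$ from $z$. Let $\mathcal R=\{(\chi,\kappa):0\le\kappa<1,\ a_1<\chi<b_s+(\frac rn-1)\kappa\}$ and let $\mathcal S_i$ be the set of $(\chi,\kappa)\in\mathcal R$ for which $F_{i,\kappa}(z)=\frac{\chi}{1-\kappa}$ has exactly one pair of non-real complex conjugate roots. \textbf{Claim.} The limits $\mathbf m_i$ exist as probability measures. Let $1\le i\le n$, and suppose that either $|J_i|\ge2$ for all large $N$, or $i=1$ and $I_2\neq\emptyset$. For $(\chi,\kappa)\in\mathcal S_i$ let $z$ be the root in the lower half plane and let $T_{\mathcal S_i}(\chi,\kappa)=t=\mathrm{St}_{\mathbf m_i}^{(-1)}(\log z)$ be the value for which the equation holds. Then $T_{\mathcal S_i}$ is a well-defined homeomorphism from $\mathcal S_i$ onto $\mathbb H=\{t:\operatorname{Im}t>0\}$.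 With $$p(t)=\sum_{l\in I_2}\frac{y_lx_1e^{\mathrm{St}_{\mathbf m_i}(t)}}{1+y_lx_1e^{\mathrm{St}_{\mathbf m_i}(t)}},\qquad q(t)=\frac{e^{\mathrm{St}_{\mathbf m_i}(t)}}{e^{\mathrm{St}_{\mathbf m_i}(t)}-1},$$ its inverse $t\mapsto(\chi_{\mathcal S_i}(t),\kappa_{\mathcal S_i}(t))$ is given, with non-vanishing denominators, for $i=1$ by $$\chi_{\mathcal S_1}(t)=\frac{\bar t(p(t)-q(t))-t(p(\bar t)-q(\bar t))-(n-1)(\bar t-t)}{n[p(t)-p(\bar t)-q(t)+q(\bar t)]},\qquad \kappa_{\mathcal S_1}(t)=\frac{\bar t-t}{p(t)-p(\bar t)-q(t)+q(\bar t)},$$ and for $2\le i\le n$ by $$\chi_{\mathcal S_i}(t)=\frac{\bar tq(t)-tq(\bar t)+(\bar t-t)(n-i)}{n[q(t)-q(\bar t)]},\qquad \kappa_{\mathcal S_i}(t)=\frac{\bar t-t}{-q(t)+q(\bar t)}.$$ -/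

import Mathlib

open Filter Topology MeasureTheory
open scoped ENNReal BoundedContinuousFunction ComplexConjugate

namespace SquareHexagon

noncomputable section

/-- The limit `N → ∞` along the multiples of the period `n`. -/
def multiplesAtTop (n : ℕ) : Filter ℕ := atTop ⊓ 𝓟 {N | n ∣ N}

/-- The counting measure `m(λ) = (1/N) ∑_{i=1}^N δ_{(λ_i + N - i)/N}` of a partition
`λ_1 ≥ ... ≥ λ_N ≥ 0`, written as a list; `j : Fin N` is the index `i = j + 1`. -/
def countingMeasure (l : List ℕ) : Measure ℝ :=
  (l.length : ℝ≥0∞)⁻¹ • ∑ j : Fin l.length,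
    Measure.dirac (((l.get j : ℝ) + (l.length : ℝ) - ((j : ℝ) + 1)) / (l.length : ℝ))

/-- Weak convergence to a probability measure on `ℝ`. -/
def IsWeakLimit (L : Filter ℕ) (ν : ℕ → Measure ℝ) (m : Measure ℝ) : Prop :=
  IsProbabilityMeasure m ∧
    ∀ f : ℝ →ᵇ ℝ, Tendsto (fun N => ∫ u, f u ∂(ν N)) L (𝓝 (∫ u, f u ∂m))

/-- The residue class modulo `n` of a position among `1, ..., N` (both indexed from `0`). -/
def weightClass (n : ℕ) [NeZero n] {N : ℕ} (j : Fin N) : Fin n := Fin.ofNat n (j : ℕ)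

/-- The `N` edge weights obtained by repeating the period `w = (x_1, ..., x_n)`. -/
def periodicWeights {n : ℕ} [NeZero n] (w : Fin n → ℝ) (N : ℕ) (j : Fin N) : ℝ :=
  w (weightClass n j)

open Classical in
/-- `η_j^σ = |{k : k > j, x_{σ(k)} ≠ x_{σ(j)}}|`. -/
def eta {N : ℕ} (X : Fin N → ℝ) (σ : Equiv.Perm (Fin N)) (j : Fin N) : ℕ :=
  (Finset.univ.filter (fun k : Fin N => j < k ∧ X (σ k) ≠ X (σ j))).card

open Classical in
/-- The partition `φ^{(i,σ)}`: the numbers `λ_j + η_j^σ` with `x_{σ(j)} = v`, counted with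
multiplicity and put in decreasing order, where `v = x_i`. -/
def phi {N : ℕ} (lam : Fin N → ℕ) (X : Fin N → ℝ) (σ : Equiv.Perm (Fin N)) (v : ℝ) : List ℕ :=
  Multiset.sort ((Finset.univ.filter (fun j : Fin N => X (σ j) = v)).val.map
    (fun j => lam j + eta X σ j)) (· ≥ ·)

/-- `J_i`: the indices `t` such that the value `μ_t` is taken by some `λ_p` at a position `p`
with `σ(p)` in the `i`-th residue class modulo `n`. -/
def valueIndices {n s N : ℕ} [NeZero n] (lam : Fin N → ℕ) (σ : Equiv.Perm (Fin N))
    (mu : Fin s → ℕ) (i : Fin n) : Set (Fin s) :=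
  {t | ∃ p : Fin N, weightClass n (σ p) = i ∧ lam p = mu t}

/-- The edge weights for given `N`: a strictly decreasing positive period `w = (x_{1,N},...,x_{n,N})`
whose first entry is `x₁`, together with a permutation `σ` of the `N` positions which puts the
periodic weights in decreasing order. -/
structure IsOrderedWeights {n : ℕ} [NeZero n] (x₁ : ℝ) (N : ℕ) (w : Fin n → ℝ)
    (σ : Equiv.Perm (Fin N)) : Prop where
  pos : ∀ i, 0 < w i
  strictAnti : StrictAnti w
  first : w 0 = x₁
  sorted : Antitone (fun j : Fin N => periodicWeights w N (σ j))

/-- The bottom boundary for given `N`: the positions `Ω_{N+1-j} = λ_j + N + 1 - j` (`1 ≤ j ≤ N`)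
of the remaining vertices form the `s` successive segments `{A_t, ..., B_t}`, and
`μ_1 > ... > μ_s` are the distinct parts of `λ`. -/
structure IsPiecewiseBoundary {s : ℕ} (N : ℕ) (lam : Fin N → ℕ) (A B mu : Fin s → ℕ) :
    Prop where
  antitone : Antitone lam
  le : ∀ t, A t ≤ B t
  lt : ∀ t t', t < t' → B t < A t'
  positions : Finset.univ.image (fun j : Fin N => lam j + (N - (j : ℕ))) =
    Finset.univ.biUnion (fun t : Fin s => Finset.Icc (A t) (B t))
  mu_strictAnti : StrictAnti mu
  mu_range : Set.range mu = Set.range lam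

/-- The Stieltjes transform `St_m(t) = ∫ m(dx) / (t - x)`. -/
def stieltjes (m : Measure ℝ) (t : ℂ) : ℂ := ∫ u : ℝ, 1 / (t - (u : ℂ)) ∂m

/-- `R_m(w) = 1 / S_m^{(-1)}(w) - 1 / w` for `S_m(ζ) = ζ + M_1 ζ² + M_2 ζ³ + ⋯`. As
`S_m(ζ) = St_m(1/ζ)`, the number `1 / S_m^{(-1)}(w)` is a value `t` of `St_m^{(-1)}` at `w`.
Since `St_m` need not be injective, this value is an argument. -/
def rTransform (w t : ℂ) : ℂ := t - 1 / w

/-- The derivative at `z` of `H_m(u) = ∫_0^{log u} R_m + log (log u / (u - 1))`, on the branch on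
which `St_m^{(-1)}(log z)` is `t`. -/
def derivH (z t : ℂ) : ℂ :=
  rTransform (Complex.log z) t / z + 1 / (z * Complex.log z) - 1 / (z - 1)

/-- The formula in `derivH` is indeed the derivative of `H_m`, for any local primitive `G` of a
branch of `R_m`. -/
theorem hasDerivAt_H {G : ℂ → ℂ} {z t : ℂ} (hz : z ∈ Complex.slitPlane) (h1 : z ≠ 1)
    (hG : HasDerivAt G (rTransform (Complex.log z) t) (Complex.log z))
    (hs : Complex.log z / (z - 1) ∈ Complex.slitPlane) :
    HasDerivAt (fun u => G (Complex.log u) + Complex.log (Complex.log u / (u - 1)))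
      (derivH z t) z := by
  have hz0 : z ≠ 0 := Complex.slitPlane_ne_zero hz
  have hz1 : z - 1 ≠ 0 := sub_ne_zero.mpr h1
  have hl : Complex.log z ≠ 0 := by
    intro h
    rw [h, zero_div] at hs
    exact Complex.slitPlane_ne_zero hs rfl
  have hlog := Complex.hasDerivAt_log hz
  have e1 := hG.comp z hlog
  have e2 : HasDerivAt (fun u => Complex.log (Complex.log u / (u - 1)))
      ((z⁻¹ * (z - 1) - Complex.log z * 1) / (z - 1) ^ 2 / (Complex.log z / (z - 1))) z :=
    (hlog.div ((hasDerivAt_id z).sub_const 1) hz1).clog hs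
  refine (e1.add e2).congr_deriv ?_
  simp only [derivH]
  field_simp
  ring

/-- `A_i(z)`, with `i : Fin n` standing for the index `i + 1`. -/
def coeffA {n : ℕ} [NeZero n] (x₁ : ℝ) (I₂ : Finset (Fin n)) (y : Fin n → ℝ) (i : Fin n) (κ : ℝ)
    (z t : ℂ) : ℂ :=
  (if i = 0 then
      ((κ : ℂ) / n) * ∑ l ∈ I₂, ((y l : ℂ) * x₁) / (1 + (y l : ℂ) * x₁ * z)
    else 0)
    - ((κ : ℂ) / n) * (((n : ℂ) - ((i : ℕ) + 1)) / z) + (1 / (n : ℂ)) * derivH z t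

/-- `F_{i,κ}(z) = (1/n) z/(z-1) + (1/(1-κ)) z A_i(z)`. -/
def funF {n : ℕ} [NeZero n] (x₁ : ℝ) (I₂ : Finset (Fin n)) (y : Fin n → ℝ) (i : Fin n) (κ : ℝ)
    (z t : ℂ) : ℂ :=
  (1 / (n : ℂ)) * (z / (z - 1)) + (1 / (1 - (κ : ℂ))) * (z * coeffA x₁ I₂ y i κ z t)

/-- `z` is a non-real root of `F_{i,κ}(z) = χ / (1 - κ)`, on the branch with
`St_m^{(-1)}(log z) = t`, where `m` is the `i`-th limit measure. -/
def IsRoot {n : ℕ} [NeZero n] (m : Measure ℝ) (x₁ : ℝ) (I₂ : Finset (Fin n)) (y : Fin n → ℝ)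
    (i : Fin n) (χ κ : ℝ) (z t : ℂ) : Prop :=
  z.im ≠ 0 ∧ stieltjes m t = Complex.log z ∧
    funF x₁ I₂ y i κ z t = (χ : ℂ) / (1 - (κ : ℂ))

/-- The limit of the rescaled lattice, in the coordinates `(χ, κ)`: it is bounded by
`χ = a_1` and `χ = b_s - (1 - r/n) κ`, where `r` is the number of indices in `I₂ ∩ {1, ..., n}`. -/
def rescaledRegion {n s : ℕ} [NeZero s] (I₂ : Finset (Fin n)) (a b : Fin s → ℝ) : Set (ℝ × ℝ) :=
  {p | 0 ≤ p.2 ∧ p.2 < 1 ∧ a 0 < p.1 ∧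
    p.1 < b (Fin.rev 0) + ((I₂.card : ℝ) / (n : ℝ) - 1) * p.2}

/-- `𝒮_i`: the points of the rescaled lattice at which `F_{i,κ}(z) = χ / (1 - κ)` has exactly one
pair of non-real complex conjugate roots. -/
def regionS {n s : ℕ} [NeZero n] [NeZero s] (m : Measure ℝ) (x₁ : ℝ) (I₂ : Finset (Fin n))
    (y : Fin n → ℝ) (a b : Fin s → ℝ) (i : Fin n) : Set (ℝ × ℝ) :=
  {p | p ∈ rescaledRegion I₂ a b ∧
    ∃ z₀ : ℂ, z₀.im ≠ 0 ∧ {z : ℂ | ∃ t, IsRoot m x₁ I₂ y i p.1 p.2 z t} = {z₀, conj z₀}}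

/-- `p(t)`. -/
def funP {n : ℕ} (m : Measure ℝ) (x₁ : ℝ) (I₂ : Finset (Fin n)) (y : Fin n → ℝ) (t : ℂ) : ℂ :=
  ∑ l ∈ I₂, ((y l : ℂ) * x₁ * Complex.exp (stieltjes m t)) /
    (1 + (y l : ℂ) * x₁ * Complex.exp (stieltjes m t))

/-- `q(t)`. -/
def funQ (m : Measure ℝ) (t : ℂ) : ℂ :=
  Complex.exp (stieltjes m t) / (Complex.exp (stieltjes m t) - 1)

end

end SquareHexagon

/-! Sorting the weights cuts the `N` positions into `n` blocks of `M = N / n`, one per class, and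
the hypothesis on the `J_i` puts each segment of the boundary into a single block. Hence the `i`-th
limit measure is Lebesgue measure on intervals `[α_k, β_k]`, each of the form `[n a_t, n b_t]`, of
total length 1 (`exists_limit_intervals`), and `exp St` is the rational function `E(t) = ∏ (t - α_k)
/ (t - β_k)`. For non-real `t` the imaginary part of `St(t)` lies in `(-π, π)`, so `St(t) = log z`
means `z = E(t)`.

The logarithms cancel in the root equation, which becomes `t = C + κ G(t)` with `C = n χ + (n - i)
κ` (`i` counted from 1), where `G = q - p` for `i = 1` and `G = q` otherwise. For fixed `t` in the
upper half plane these are two real linear equations in `(χ, κ)`, solvable because `Im G(t) > 0`;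
this is the explicit inverse. It remains to see that the solution lies in `ℛ` and that `(χ, κ)`
determines `t`.

All estimates rest on `E = 1 + ∑ u_k / (t - β_k)` with `u_k > 0` and `∑ u_k = 1`. Cauchy-Schwarz
gives `Im G > Im t`, hence `κ < 1` (`im_lt_im_slopeFun`). Multiplying by the conjugate of `t` minus
an extreme endpoint and taking imaginary parts bounds `χ` (`lt_of_fixed`, `fixed_lt`). Two solutions
for the same `(χ, κ)` would give equality in another Cauchy-Schwarz inequality, making certain terms
conjugate to each other, which is impossible if both lie in the upper half plane (`fixed_unique`).
Strictness needs two intervals or a nonempty `I₂`: for one interval and no `p`, `G(t) = t - α`.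
Continuity of `(χ, κ) ↦ t` follows from uniqueness and the maximum principle
(`exists_homeomorph_fixed`). -/

namespace SquareHexagon

/-! ### Partial fractions with interlacing zeros and poles -/

section PartialFractions

variable {ι : Type*} [DecidableEq ι]

/-- The residue at `b k` of the rational function `∏ (X - a j) / (X - b j)`. -/
noncomputable def residue {F : Type*} [Field F] (T : Finset ι) (a b : ι → F) (k : ι) : F :=
  (∏ j ∈ T, (b k - a j)) / ∏ j ∈ T.erase k, (b k - b j)

omit [DecidableEq ι] in
lemma degree_nodal_sub_nodal_lt {F : Type*} [Field F] (T : Finset ι) (a b : ι → F) :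
    (Lagrange.nodal T a - Lagrange.nodal T b).degree < T.card := by
  have h := Polynomial.degree_sub_lt_left (p := Lagrange.nodal T a) (q := Lagrange.nodal T b)
    (by rw [Lagrange.degree_nodal, Lagrange.degree_nodal]) Lagrange.nodal_ne_zero
    (by rw [Lagrange.nodal_monic.leadingCoeff, Lagrange.nodal_monic.leadingCoeff])
  rwa [Lagrange.degree_nodal] at h

/-- Partial fraction expansion of `∏ (t - a k) / (t - b k)`. -/
lemma prod_div_eq_one_add_sum {F : Type*} [Field F] (T : Finset ι) (a b : ι → F)
    (hb : Set.InjOn b T) {t : F} (ht : ∀ k ∈ T, t ≠ b k) :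
    ∏ k ∈ T, (t - a k) / (t - b k) = 1 + ∑ k ∈ T, residue T a b k / (t - b k) := by
  have h := Lagrange.eq_interpolate hb (degree_nodal_sub_nodal_lt T a b)
  have h2 := congrArg (Polynomial.eval t) h
  rw [Lagrange.eval_interpolate_not_at_node _ ht, Polynomial.eval_sub, Lagrange.eval_nodal,
    Lagrange.eval_nodal] at h2
  have hne : ∏ k ∈ T, (t - b k) ≠ 0 :=
    Finset.prod_ne_zero_iff.mpr fun k hk => sub_ne_zero.mpr (ht k hk)
  rw [Finset.prod_div_distrib, div_eq_iff hne, add_mul, one_mul, ← sub_eq_iff_eq_add', h2, mul_comm]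
  congr 1
  refine Finset.sum_congr rfl fun k hk => ?_
  rw [Polynomial.eval_sub, Lagrange.eval_nodal_at_node hk, Lagrange.eval_nodal, residue,
    Lagrange.nodalWeight, Finset.prod_inv_distrib]
  ring

/-- Compare the coefficients of degree `T.card - 1` in the difference of the nodal polynomials and
in its Lagrange interpolant. When the total length is 1, the residues form a probability vector. -/
lemma sum_residue {F : Type*} [Field F] (T : Finset ι) (a b : ι → F) (hb : Set.InjOn b T) :
    ∑ k ∈ T, residue T a b k = ∑ k ∈ T, (b k - a k) := by
  rcases T.eq_empty_or_nonempty with rfl | hT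
  · simp
  have h := Lagrange.coeff_eq_sum hb (degree_nodal_sub_nodal_lt T a b)
  rw [Polynomial.coeff_sub, Lagrange.nodal_eq, Lagrange.nodal_eq,
    Polynomial.prod_X_sub_C_coeff_card_pred _ _ hT.card_pos,
    Polynomial.prod_X_sub_C_coeff_card_pred _ _ hT.card_pos] at h
  rw [Finset.sum_sub_distrib, ← neg_sub_neg, h]
  refine Finset.sum_congr rfl fun k hk => ?_
  rw [Polynomial.eval_sub, ← Lagrange.nodal_eq, ← Lagrange.nodal_eq,
    Lagrange.eval_nodal_at_node hk, Lagrange.eval_nodal, residue, sub_zero]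

lemma residue_eq {F : Type*} [Field F] {T : Finset ι} (a b : ι → F) {k : ι} (hk : k ∈ T) :
    residue T a b k = (b k - a k) * ∏ j ∈ T.erase k, (b k - a j) / (b k - b j) := by
  rw [residue, ← Finset.mul_prod_erase T _ hk, Finset.prod_div_distrib, mul_div_assoc]

/-- The intervals `[α k, β k]`, `k ∈ T`, are non-degenerate and pairwise disjoint. -/
structure DisjointIntervals (T : Finset ι) (α β : ι → ℝ) : Prop where
  lt : ∀ k ∈ T, α k < β k
  sep : ∀ j ∈ T, ∀ k ∈ T, j ≠ k → β j < α k ∨ β k < α j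

namespace DisjointIntervals

variable {T : Finset ι} {α β : ι → ℝ} (h : DisjointIntervals T α β)
include h

lemma injOn_right : Set.InjOn β T := by
  intro j hj k hk hjk
  by_contra hne
  have h1 := h.lt j hj
  have h2 := h.lt k hk
  rcases h.sep j hj k hk hne with h3 | h3 <;> linarith

lemma injOn_left : Set.InjOn α T := by
  intro j hj k hk hjk
  by_contra hne
  have h1 := h.lt j hj
  have h2 := h.lt k hk
  rcases h.sep j hj k hk hne with h3 | h3 <;> linarith

/-- Disjointness puts `α j` and `β j` on the same side of `β k`, so every factor with `j ≠ k` is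
positive and the sign is that of `β k - α k`. -/
lemma residue_right_pos {k : ι} (hk : k ∈ T) : 0 < residue T α β k := by
  rw [residue_eq _ _ hk]
  refine mul_pos (sub_pos.mpr (h.lt k hk)) (Finset.prod_pos fun j hj => ?_)
  obtain ⟨hjk, hj⟩ := Finset.mem_erase.mp hj
  have h1 := h.lt j hj
  have h2 := h.lt k hk
  rcases h.sep j hj k hk hjk with h3 | h3
  · exact div_pos (by linarith) (by linarith)
  · exact div_pos_of_neg_of_neg (by linarith) (by linarith)

lemma residue_left_neg {k : ι} (hk : k ∈ T) : residue T β α k < 0 := by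
  rw [residue_eq _ _ hk]
  refine mul_neg_of_neg_of_pos (sub_neg.mpr (h.lt k hk)) (Finset.prod_pos fun j hj => ?_)
  obtain ⟨hjk, hj⟩ := Finset.mem_erase.mp hj
  have h1 := h.lt j hj
  have h2 := h.lt k hk
  rcases h.sep j hj k hk hjk with h3 | h3
  · exact div_pos (by linarith) (by linarith)
  · exact div_pos_of_neg_of_neg (by linarith) (by linarith)

end DisjointIntervals

end PartialFractions

/-! ### Estimates in the upper half plane -/

section UpperHalfPlaneEstimates

lemma sub_ofReal_ne_zero {t : ℂ} (ht : t.im ≠ 0) (x : ℝ) : t - x ≠ 0 := by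
  intro h
  apply ht
  have := congrArg Complex.im h
  simpa using this

lemma im_ofReal_div_sub (t : ℂ) (r b : ℝ) :
    ((r : ℂ) / (t - b)).im = -t.im * (r / Complex.normSq (t - b)) := by
  rw [Complex.div_im]
  simp
  ring

lemma im_conj_mul_inv (s g : ℂ) : (conj s * g⁻¹).im = -(s * g).im / Complex.normSq g := by
  rw [← div_eq_mul_inv, Complex.div_im]
  simp
  ring

variable {ι κ : Type*} [DecidableEq ι]

omit [DecidableEq ι] in
lemma nonempty_of_sum_eq_one {T : Finset ι} {f : ι → ℝ} (hsum : ∑ k ∈ T, f k = 1) : T.Nonempty := by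
  rw [Finset.nonempty_iff_ne_empty]
  rintro rfl
  simp at hsum

/-- The function `exp St`, for the uniform measure on a union of intervals. -/
noncomputable def endpointProd (T : Finset ι) (α β : ι → ℝ) (t : ℂ) : ℂ :=
  ∏ k ∈ T, (t - α k) / (t - β k)

/-- The function `z / (z - 1) - ∑ c z / (1 + c z)`. -/
noncomputable def slopeFun (L : Finset κ) (c : κ → ℝ) (z : ℂ) : ℂ :=
  z / (z - 1) - ∑ l ∈ L, (c l * z) / (1 + c l * z)

lemma endpointProd_eq {T : Finset ι} {α β : ι → ℝ} (hβ : Set.InjOn β T) {t : ℂ} (ht : t.im ≠ 0) :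
    endpointProd T α β t = 1 + ∑ k ∈ T, ((residue T α β k : ℝ) : ℂ) / (t - β k) := by
  have h := prod_div_eq_one_add_sum T (fun k => (α k : ℂ)) (fun k => (β k : ℂ))
    (fun j hj k hk hjk => hβ hj hk (Complex.ofReal_injective hjk)) (t := t)
    (fun k _ => sub_ne_zero.mp (sub_ofReal_ne_zero ht _))
  rw [endpointProd, h]
  simp [residue]

-- Inversion exchanges left and right endpoints, so estimates at the right endpoints have twins at
-- the left ones.
omit [DecidableEq ι] in
lemma endpointProd_inv (T : Finset ι) (α β : ι → ℝ) (t : ℂ) :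
    (endpointProd T α β t)⁻¹ = endpointProd T β α t := by
  simp [endpointProd]

omit [DecidableEq ι] in
lemma endpointProd_ne_zero (T : Finset ι) (α β : ι → ℝ) {t : ℂ} (ht : t.im ≠ 0) :
    endpointProd T α β t ≠ 0 :=
  Finset.prod_ne_zero_iff.mpr fun _ _ =>
    div_ne_zero (sub_ofReal_ne_zero ht _) (sub_ofReal_ne_zero ht _)

lemma im_endpointProd {T : Finset ι} {α β : ι → ℝ} (hβ : Set.InjOn β T) {t : ℂ} (ht : t.im ≠ 0) :
    (endpointProd T α β t).im =
      -t.im * ∑ k ∈ T, residue T α β k / Complex.normSq (t - β k) := by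
  rw [endpointProd_eq hβ ht, Complex.add_im, Complex.im_sum, Finset.mul_sum]
  simp [im_ofReal_div_sub]

/-- Since `(t - b) / (t - β k) = 1 + (β k - b) / (t - β k)`, the factor `t - b` only adds real
constants. The sign is then visible when `b` lies to one side of all the poles. -/
lemma im_sub_mul_endpointProd_sub_one {T : Finset ι} {α β : ι → ℝ} (hβ : Set.InjOn β T) {t : ℂ}
    (ht : t.im ≠ 0) (b : ℝ) :
    ((t - b) * (endpointProd T α β t - 1)).im =
      t.im * ∑ k ∈ T, residue T α β k * (b - β k) / Complex.normSq (t - β k) := by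
  rw [endpointProd_eq hβ ht, add_sub_cancel_left, Finset.mul_sum, Complex.im_sum, Finset.mul_sum]
  refine Finset.sum_congr rfl fun k _ => ?_
  have h : (t - b) * (((residue T α β k : ℝ) : ℂ) / (t - β k)) =
      ((residue T α β k : ℝ) : ℂ) + ((residue T α β k * (β k - b) : ℝ) : ℂ) / (t - β k) := by
    have := sub_ofReal_ne_zero ht (β k)
    push_cast
    field_simp
    ring
  rw [h, Complex.add_im, im_ofReal_div_sub, Complex.ofReal_im]
  ring

lemma normSq_sub_pos {t : ℂ} (ht : t.im ≠ 0) (x : ℝ) : 0 < Complex.normSq (t - x) :=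
  Complex.normSq_pos.mpr (sub_ofReal_ne_zero ht x)

section Signs

variable {T : Finset ι} {α β : ι → ℝ} (hI : DisjointIntervals T α β) {t : ℂ} (ht : 0 < t.im)
include hI ht

lemma im_endpointProd_neg (hT : T.Nonempty) : (endpointProd T α β t).im < 0 := by
  rw [im_endpointProd hI.injOn_right ht.ne']
  refine mul_neg_of_neg_of_pos (neg_lt_zero.mpr ht) (Finset.sum_pos (fun k hk => ?_) hT)
  exact div_pos (hI.residue_right_pos hk) (normSq_sub_pos ht.ne' _)

lemma im_sub_mul_right_nonneg {b : ℝ} (hb : ∀ k ∈ T, β k ≤ b) :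
    0 ≤ ((t - b) * (endpointProd T α β t - 1)).im := by
  rw [im_sub_mul_endpointProd_sub_one hI.injOn_right ht.ne']
  refine mul_nonneg ht.le (Finset.sum_nonneg fun k hk => ?_)
  exact div_nonneg (mul_nonneg (hI.residue_right_pos hk).le (sub_nonneg.mpr (hb k hk)))
    (normSq_sub_pos ht.ne' _).le

lemma im_sub_mul_right_pos {b : ℝ} (hb : ∀ k ∈ T, β k ≤ b) (hT : 2 ≤ T.card) :
    0 < ((t - b) * (endpointProd T α β t - 1)).im := by
  rw [im_sub_mul_endpointProd_sub_one hI.injOn_right ht.ne']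
  obtain ⟨j, hj, k, hk, hjk⟩ := Finset.one_lt_card.mp hT
  -- Two distinct right endpoints cannot both equal `b`.
  have hex : ∃ k ∈ T, β k < b := by
    by_contra! hcon
    exact hjk (hI.injOn_right hj hk
      (((hb j hj).antisymm (hcon j hj)).trans ((hb k hk).antisymm (hcon k hk)).symm))
  refine mul_pos ht (Finset.sum_pos' (fun k hk => ?_) ?_)
  · exact div_nonneg (mul_nonneg (hI.residue_right_pos hk).le (sub_nonneg.mpr (hb k hk)))
      (normSq_sub_pos ht.ne' _).le
  · obtain ⟨k, hk, hkb⟩ := hex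
    exact ⟨k, hk, div_pos (mul_pos (hI.residue_right_pos hk) (sub_pos.mpr hkb))
      (normSq_sub_pos ht.ne' _)⟩

lemma im_sub_mul_left_nonneg {a : ℝ} (ha : ∀ k ∈ T, a ≤ α k) :
    0 ≤ ((t - a) * ((endpointProd T α β t)⁻¹ - 1)).im := by
  rw [endpointProd_inv, im_sub_mul_endpointProd_sub_one hI.injOn_left ht.ne']
  refine mul_nonneg ht.le (Finset.sum_nonneg fun k hk => ?_)
  exact div_nonneg (mul_nonneg_of_nonpos_of_nonpos (hI.residue_left_neg hk).le
    (sub_nonpos.mpr (ha k hk))) (normSq_sub_pos ht.ne' _).le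

lemma im_sub_mul_left_pos {a : ℝ} (ha : ∀ k ∈ T, a ≤ α k) (hT : 2 ≤ T.card) :
    0 < ((t - a) * ((endpointProd T α β t)⁻¹ - 1)).im := by
  rw [endpointProd_inv, im_sub_mul_endpointProd_sub_one hI.injOn_left ht.ne']
  obtain ⟨j, hj, k, hk, hjk⟩ := Finset.one_lt_card.mp hT
  have hex : ∃ k ∈ T, a < α k := by
    by_contra! hcon
    exact hjk (hI.injOn_left hj hk
      (((hcon j hj).antisymm (ha j hj)).trans ((hcon k hk).antisymm (ha k hk)).symm))
  refine mul_pos ht (Finset.sum_pos' (fun k hk => ?_) ?_)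
  · exact div_nonneg (mul_nonneg_of_nonpos_of_nonpos (hI.residue_left_neg hk).le
      (sub_nonpos.mpr (ha k hk))) (normSq_sub_pos ht.ne' _).le
  · obtain ⟨k, hk, hka⟩ := hex
    exact ⟨k, hk, div_pos (mul_pos_of_neg_of_neg (hI.residue_left_neg hk) (sub_neg.mpr hka))
      (normSq_sub_pos ht.ne' _)⟩

/-- `|exp St - 1|²` against the imaginary part of `exp St`, by the Cauchy-Schwarz inequality. -/
lemma im_mul_normSq_sub_one_le (hsum : ∑ k ∈ T, (β k - α k) = 1) :
    t.im * Complex.normSq (endpointProd T α β t - 1) ≤ -(endpointProd T α β t).im ∧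
      (2 ≤ T.card →
        t.im * Complex.normSq (endpointProd T α β t - 1) < -(endpointProd T α β t).im) := by
  have hu : ∑ k ∈ T, residue T α β k = 1 := (sum_residue T α β hI.injOn_right).trans hsum
  have h0 := endpointProd_eq (α := α) hI.injOn_right ht.ne'
  rw [im_endpointProd hI.injOn_right ht.ne']
  set z := endpointProd T α β t
  set u := residue T α β
  have hupos : ∀ k ∈ T, 0 < u k := fun k hk => hI.residue_right_pos hk
  set ξ : ι → ℂ := fun k => (t - β k)⁻¹
  have h1 : z - 1 = ∑ k ∈ T, (u k : ℂ) * ξ k := by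
    simp only [h0, add_sub_cancel_left, ξ, div_eq_mul_inv]
  -- Variance identity: `z - 1` is the mean of the `ξ k` for the probability weights `u k`, and the
  -- first sum on the right equals `-z.im / t.im`.
  have key : ∑ k ∈ T, u k * Complex.normSq (ξ k - (z - 1)) =
      ∑ k ∈ T, u k / Complex.normSq (t - β k) - Complex.normSq (z - 1) := by
    have e1 : ∀ k ∈ T, u k * Complex.normSq (ξ k - (z - 1)) =
        u k / Complex.normSq (t - β k) + u k * Complex.normSq (z - 1) -
          2 * ((u k : ℂ) * ξ k * conj (z - 1)).re := by
      intro k _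
      rw [Complex.normSq_sub, Complex.normSq_inv, mul_assoc (u k : ℂ), Complex.re_ofReal_mul]
      ring
    rw [Finset.sum_congr rfl e1, Finset.sum_sub_distrib, Finset.sum_add_distrib, ← Finset.sum_mul,
      hu, ← Finset.mul_sum, ← Complex.re_sum, ← Finset.sum_mul, ← h1, Complex.mul_conj,
      Complex.ofReal_re]
    ring
  have hnn : ∀ k ∈ T, 0 ≤ u k * Complex.normSq (ξ k - (z - 1)) := fun k hk =>
    mul_nonneg (hupos k hk).le (Complex.normSq_nonneg _)
  constructor
  · have := Finset.sum_nonneg hnn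
    rw [key] at this
    nlinarith
  · intro hT
    have : 0 < ∑ k ∈ T, u k * Complex.normSq (ξ k - (z - 1)) := by
      obtain ⟨j, hj, k, hk, hjk⟩ := Finset.one_lt_card.mp hT
      refine Finset.sum_pos' hnn ?_
      by_contra! hcon
      have hz : ∀ i ∈ T, ξ i = z - 1 := by
        intro i hi
        have h2 := (hcon i hi).antisymm (hnn i hi)
        exact sub_eq_zero.mp (Complex.normSq_eq_zero.mp
          ((mul_eq_zero.mp h2).resolve_left (hupos i hi).ne'))
      have h3 := inv_injective ((hz j hj).trans (hz k hk).symm)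
      exact hjk (hI.injOn_right hj hk (Complex.ofReal_injective (sub_right_injective h3)))
    rw [key] at this
    nlinarith

end Signs

section Slope

variable (L : Finset κ) (c : κ → ℝ)

lemma one_add_mul_ne_zero {z : ℂ} (hz : z.im ≠ 0) {c : ℝ} (hc : 0 < c) : 1 + (c : ℂ) * z ≠ 0 := by
  intro h
  have := congrArg Complex.im h
  simp [hz, hc.ne'] at this

lemma sub_one_ne_zero_of_im {z : ℂ} (hz : z.im ≠ 0) : z - 1 ≠ 0 := by
  simpa using sub_ofReal_ne_zero hz 1

variable {L c}

/-- The value `1 - L.card` at infinity is split off; what remains is a sum of reciprocals of affine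
functions with positive slopes. -/
lemma slopeFun_eq (hc : ∀ l ∈ L, 0 < c l) {z : ℂ} (hz : z.im ≠ 0) :
    slopeFun L c z = 1 - L.card + ((z - 1)⁻¹ + ∑ l ∈ L, (1 + c l * z)⁻¹) := by
  have h1 : ∀ l ∈ L, (c l * z) / (1 + c l * z) = 1 - (1 + c l * z)⁻¹ := by
    intro l hl
    have := one_add_mul_ne_zero hz (hc l hl)
    field_simp
    ring
  have := sub_one_ne_zero_of_im hz
  rw [slopeFun, Finset.sum_congr rfl h1, Finset.sum_sub_distrib]
  have h2 : z / (z - 1) = 1 + (z - 1)⁻¹ := by field_simp; ring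
  rw [h2]
  simp
  ring

lemma im_slopeFun (hc : ∀ l ∈ L, 0 < c l) {z : ℂ} (hz : z.im ≠ 0) :
    (slopeFun L c z).im = -z.im *
      ((Complex.normSq (z - 1))⁻¹ + ∑ l ∈ L, c l / Complex.normSq (1 + c l * z)) := by
  rw [slopeFun_eq hc hz, Complex.add_im, Complex.add_im, Complex.im_sum, mul_add, Finset.mul_sum]
  have h0 : (1 - (L.card : ℂ)).im = 0 := by simp
  rw [h0, zero_add]
  congr 1
  · rw [Complex.inv_im]; simp; ring
  · refine Finset.sum_congr rfl fun l _ => ?_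
    rw [Complex.inv_im]; simp; ring

end Slope

/-! ### Bounds on the parameters of a fixed point -/

section Estimates

variable {T : Finset ι} {α β : ι → ℝ} (hI : DisjointIntervals T α β)
  (hsum : ∑ k ∈ T, (β k - α k) = 1) {L : Finset κ} {c : κ → ℝ} (hc : ∀ l ∈ L, 0 < c l)
  (hne : 2 ≤ T.card ∨ L.Nonempty) {t : ℂ} (ht : 0 < t.im)
include hI hsum hc hne ht

/-- A fixed point satisfies `t.im = κ * (G t).im`, so this bound yields `κ < 1`. The term `(z -
1)⁻¹` alone contributes at least `t.im` by Cauchy-Schwarz; strictness comes from a second interval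
or from a term of `L`. -/
lemma im_lt_im_slopeFun : t.im < (slopeFun L c (endpointProd T α β t)).im := by
  have hT := nonempty_of_sum_eq_one hsum
  have hz := im_endpointProd_neg hI ht hT
  obtain ⟨h1, h2⟩ := im_mul_normSq_sub_one_le hI ht hsum
  rw [im_slopeFun hc hz.ne]
  set z := endpointProd T α β t
  have hn : 0 < Complex.normSq (z - 1) := Complex.normSq_pos.mpr (sub_one_ne_zero_of_im hz.ne)
  have hpos : ∀ l ∈ L, 0 < c l / Complex.normSq (1 + c l * z) := fun l hl =>
    div_pos (hc l hl) (Complex.normSq_pos.mpr (one_add_mul_ne_zero hz.ne (hc l hl)))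
  rw [mul_add, ← div_eq_mul_inv]
  rcases hne with h | h
  · have h3 : t.im < -z.im / Complex.normSq (z - 1) := (lt_div_iff₀ hn).mpr (h2 h)
    have h4 : 0 ≤ -z.im * ∑ l ∈ L, c l / Complex.normSq (1 + c l * z) :=
      mul_nonneg (by linarith) (Finset.sum_nonneg fun l hl => (hpos l hl).le)
    linarith
  · have h3 : t.im ≤ -z.im / Complex.normSq (z - 1) := (le_div_iff₀ hn).mpr h1
    have h4 : 0 < -z.im * ∑ l ∈ L, c l / Complex.normSq (1 + c l * z) :=
      mul_pos (by linarith) (Finset.sum_pos hpos h)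
    linarith

/-- In terms of `z⁻¹`, whose poles are the left endpoints, `conj (t - a) * slopeFun L c z` has
positive imaginary part. By the fixed-point equation, `x` times this imaginary part is `(C - a) *
t.im`. -/
lemma lt_of_fixed {a : ℝ} (ha : ∀ k ∈ T, a ≤ α k) {C x : ℝ} (hx : 0 < x)
    (hfix : t = C + x * slopeFun L c (endpointProd T α β t)) : a < C := by
  have hT := nonempty_of_sum_eq_one hsum
  have hz := im_endpointProd_neg hI ht hT
  have hz0 := endpointProd_ne_zero T α β ht.ne'
  have h1 := im_sub_mul_left_nonneg hI ht ha
  have h2 := im_sub_mul_left_pos hI ht ha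
  set z := endpointProd T α β t
  have hz1 := sub_one_ne_zero_of_im hz.ne
  have hinv : z⁻¹ - 1 ≠ 0 := by
    intro h
    apply hz1
    field_simp at h
    linear_combination -h
  have eG : slopeFun L c z = -((z⁻¹ - 1)⁻¹ + ∑ l ∈ L, (1 + (c l : ℂ)⁻¹ * z⁻¹)⁻¹) := by
    have e1 : z / (z - 1) = -(z⁻¹ - 1)⁻¹ := by
      have : z⁻¹ - 1 = -(z - 1) / z := by field_simp; ring
      rw [this, inv_div, div_neg, neg_neg]
    have e2 : ∀ l ∈ L, (c l * z) / (1 + c l * z) = (1 + (c l : ℂ)⁻¹ * z⁻¹)⁻¹ := by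
      intro l hl
      have h3 := one_add_mul_ne_zero hz.ne (hc l hl)
      have h4 : (c l : ℂ) ≠ 0 := Complex.ofReal_ne_zero.mpr (hc l hl).ne'
      have : 1 + (c l : ℂ)⁻¹ * z⁻¹ = (1 + c l * z) / (c l * z) := by field_simp; ring
      rw [this, inv_div]
    rw [slopeFun, Finset.sum_congr rfl e2, e1]
    ring
  have hl : ∀ l ∈ L, 0 < ((t - a) * (1 + (c l : ℂ)⁻¹ * z⁻¹)).im := by
    intro l hl
    have hcl : 0 < (c l)⁻¹ := inv_pos.mpr (hc l hl)
    have e : (t - a) * (1 + (c l : ℂ)⁻¹ * z⁻¹) =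
        (((c l)⁻¹ : ℝ) : ℂ) * ((t - a) * (z⁻¹ - 1)) + ((1 + (c l)⁻¹ : ℝ) : ℂ) * (t - a) := by
      push_cast; ring
    rw [e, Complex.add_im, Complex.im_ofReal_mul, Complex.im_ofReal_mul]
    have : (t - (a : ℂ)).im = t.im := by simp
    rw [this]
    have := mul_nonneg hcl.le h1
    have : 0 < (1 + (c l)⁻¹) * t.im := by positivity
    linarith
  have hpos : 0 < (conj (t - a) * slopeFun L c z).im := by
    rw [eG, mul_neg, mul_add, Finset.mul_sum, Complex.neg_im, Complex.add_im, Complex.im_sum]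
    simp only [im_conj_mul_inv]
    have p1 : 0 ≤ ((t - a) * (z⁻¹ - 1)).im / Complex.normSq (z⁻¹ - 1) :=
      div_nonneg h1 (Complex.normSq_nonneg _)
    have p2 : ∀ l ∈ L, 0 < ((t - a) * (1 + (c l : ℂ)⁻¹ * z⁻¹)).im /
        Complex.normSq (1 + (c l : ℂ)⁻¹ * z⁻¹) := by
      intro l hl'
      refine div_pos (hl l hl') (Complex.normSq_pos.mpr fun h => ?_)
      have := hl l hl'
      rw [h] at this
      simp at this
    simp only [neg_div, Finset.sum_neg_distrib]
    rcases hne with h | h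
    · have p3 : 0 < ((t - a) * (z⁻¹ - 1)).im / Complex.normSq (z⁻¹ - 1) :=
        div_pos (h2 h) (Complex.normSq_pos.mpr hinv)
      have := Finset.sum_nonneg fun l hl => (p2 l hl).le
      linarith
    · have := Finset.sum_pos p2 h
      linarith
  have e : (x : ℂ) * (conj (t - a) * slopeFun L c z) =
      ((Complex.normSq (t - a) : ℝ) : ℂ) + ((a - C : ℝ) : ℂ) * conj (t - a) := by
    rw [Complex.normSq_eq_conj_mul_self]
    push_cast
    linear_combination (-conj (t - (a : ℂ))) * hfix
  have e2 := congrArg Complex.im e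
  rw [Complex.im_ofReal_mul, Complex.add_im, Complex.im_ofReal_mul, Complex.ofReal_im,
    Complex.conj_im] at e2
  have : (t - (a : ℂ)).im = t.im := by simp
  rw [this] at e2
  have := mul_pos hx hpos
  by_contra! hcon
  have : 0 ≤ (a - C) * t.im := mul_nonneg (by linarith) ht.le
  linarith

/-- Mirror image of `lt_of_fixed` at the right endpoints. The constant `1 - L.card` is moved into
`C`, since the sign argument applies only to the remaining reciprocals. -/
lemma fixed_lt {b : ℝ} (hb : ∀ k ∈ T, β k ≤ b) {C x : ℝ} (hx : 0 < x)
    (hfix : t = C + x * slopeFun L c (endpointProd T α β t)) : C + x * (1 - L.card) < b := by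
  have hT := nonempty_of_sum_eq_one hsum
  have hz := im_endpointProd_neg hI ht hT
  have h1 := im_sub_mul_right_nonneg hI ht hb
  have h2 := im_sub_mul_right_pos hI ht hb
  set z := endpointProd T α β t
  have hz1 := sub_one_ne_zero_of_im hz.ne
  rw [slopeFun_eq hc hz.ne] at hfix
  have hl : ∀ l ∈ L, 0 < ((t - b) * (1 + c l * z)).im := by
    intro l hl
    have hcl := hc l hl
    have e : (t - b) * (1 + c l * z) =
        (c l : ℂ) * ((t - b) * (z - 1)) + ((1 + c l : ℝ) : ℂ) * (t - b) := by
      push_cast; ring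
    rw [e, Complex.add_im, Complex.im_ofReal_mul, Complex.im_ofReal_mul]
    have : (t - (b : ℂ)).im = t.im := by simp
    rw [this]
    have := mul_nonneg hcl.le h1
    have : 0 < (1 + c l) * t.im := by positivity
    linarith
  set G' := (z - 1)⁻¹ + ∑ l ∈ L, (1 + c l * z)⁻¹ with hG'
  have hneg : (conj (t - b) * G').im < 0 := by
    rw [hG', mul_add, Finset.mul_sum, Complex.add_im, Complex.im_sum]
    simp only [im_conj_mul_inv]
    have p1 : 0 ≤ ((t - b) * (z - 1)).im / Complex.normSq (z - 1) :=
      div_nonneg h1 (Complex.normSq_nonneg _)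
    have p2 : ∀ l ∈ L, 0 < ((t - b) * (1 + c l * z)).im / Complex.normSq (1 + c l * z) :=
      fun l hl' => div_pos (hl l hl')
        (Complex.normSq_pos.mpr (one_add_mul_ne_zero hz.ne (hc l hl')))
    simp only [neg_div, Finset.sum_neg_distrib]
    rcases hne with h | h
    · have p3 : 0 < ((t - b) * (z - 1)).im / Complex.normSq (z - 1) :=
        div_pos (h2 h) (Complex.normSq_pos.mpr hz1)
      have := Finset.sum_nonneg fun l hl => (p2 l hl).le
      linarith
    · have := Finset.sum_pos p2 h
      linarith
  have e : (x : ℂ) * (conj (t - b) * G') =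
      ((Complex.normSq (t - b) : ℝ) : ℂ) + ((b - (C + x * (1 - L.card)) : ℝ) : ℂ) * conj (t - b) := by
    rw [Complex.normSq_eq_conj_mul_self]
    push_cast
    linear_combination (-conj (t - (b : ℂ))) * hfix
  have e2 := congrArg Complex.im e
  rw [Complex.im_ofReal_mul, Complex.add_im, Complex.im_ofReal_mul, Complex.ofReal_im,
    Complex.conj_im] at e2
  have : (t - (b : ℂ)).im = t.im := by simp
  rw [this] at e2
  have := mul_neg_of_pos_of_neg hx hneg
  by_contra! hcon
  have : (b - (C + x * (1 - L.card))) * t.im ≤ 0 :=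
    mul_nonpos_of_nonpos_of_nonneg (by linarith) ht.le
  linarith

end Estimates

end UpperHalfPlaneEstimates

/-! ### Uniqueness of the fixed point -/

section Uniqueness

/-- Equality case of Cauchy-Schwarz: the weighted sum of `|X j - conj (Y j)|²` is `1 + 1 - 2 = 0`.
-/
lemma eq_conj_of_sum_eq_one {ι : Type*} (s : Finset ι) (W : ι → ℝ) (X Y : ι → ℂ)
    (hW : ∀ j ∈ s, 0 < W j) (hX : ∑ j ∈ s, W j * Complex.normSq (X j) = 1)
    (hY : ∑ j ∈ s, W j * Complex.normSq (Y j) = 1) (hXY : ∑ j ∈ s, (W j : ℂ) * (X j * Y j) = 1) :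
    ∀ j ∈ s, X j = conj (Y j) := by
  have h : ∑ j ∈ s, W j * Complex.normSq (X j - conj (Y j)) = 0 := by
    have e : ∀ j ∈ s, W j * Complex.normSq (X j - conj (Y j)) =
        W j * Complex.normSq (X j) + W j * Complex.normSq (Y j) -
          2 * ((W j : ℂ) * (X j * Y j)).re := by
      intro j _
      rw [Complex.normSq_sub, Complex.conj_conj, Complex.normSq_conj, Complex.re_ofReal_mul]
      ring
    rw [Finset.sum_congr rfl e, Finset.sum_sub_distrib, Finset.sum_add_distrib, hX, hY,
      ← Finset.mul_sum, ← Complex.re_sum, hXY]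
    norm_num
  intro j hj
  have h2 := (Finset.sum_eq_zero_iff_of_nonneg fun k hk =>
    mul_nonneg (hW k hk).le (Complex.normSq_nonneg _)).mp h j hj
  exact sub_eq_zero.mp (Complex.normSq_eq_zero.mp ((mul_eq_zero.mp h2).resolve_left (hW j hj).ne'))

variable {ι κ : Type*} [DecidableEq ι]

/-- The weights of the terms `z - 1` and `1 + c l * z` in `slopeFun`. -/
def slopeWeight (c : κ → ℝ) : Option κ → ℝ
  | none => 1
  | some l => c l

/-- The terms `z - 1` and `1 + c l * z` of `slopeFun`. -/
def slopeTerm (c : κ → ℝ) (z : ℂ) : Option κ → ℂ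
  | none => z - 1
  | some l => 1 + c l * z

lemma slopeWeight_pos {L : Finset κ} {c : κ → ℝ} (hc : ∀ l ∈ L, 0 < c l) :
    ∀ o ∈ Finset.insertNone L, 0 < slopeWeight c o
  | none, _ => one_pos
  | some l, hl => hc l (by simpa using hl)

/-- Polarised form of `im_slopeFun`: products of reciprocals at `z` and `w` replace squared norms.
-/
lemma slopeFun_sub {L : Finset κ} {c : κ → ℝ} (hc : ∀ l ∈ L, 0 < c l) {z w : ℂ}
    (hz : z.im ≠ 0) (hw : w.im ≠ 0) :
    slopeFun L c z - slopeFun L c w = -(z - w) *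
      ∑ o ∈ Finset.insertNone L, (slopeWeight c o : ℂ) * ((slopeTerm c z o)⁻¹ * (slopeTerm c w o)⁻¹)
    := by
  rw [slopeFun_eq hc hz, slopeFun_eq hc hw, Finset.sum_insertNone, mul_add, Finset.mul_sum,
    add_sub_add_left_eq_sub, add_sub_add_comm, ← Finset.sum_sub_distrib]
  congr 1
  · have := sub_one_ne_zero_of_im hz
    have := sub_one_ne_zero_of_im hw
    simp only [slopeTerm, slopeWeight]
    field_simp
    push_cast
    ring
  · refine Finset.sum_congr rfl fun l hl => ?_
    have := one_add_mul_ne_zero hz (hc l hl)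
    have := one_add_mul_ne_zero hw (hc l hl)
    simp only [slopeTerm, slopeWeight]
    field_simp
    ring

lemma endpointProd_sub {T : Finset ι} {α β : ι → ℝ} (hβ : Set.InjOn β T) {t s : ℂ} (ht : t.im ≠ 0)
    (hs : s.im ≠ 0) : endpointProd T α β t - endpointProd T α β s = -(t - s) *
      ∑ k ∈ T, ((residue T α β k : ℝ) : ℂ) * ((t - β k)⁻¹ * (s - β k)⁻¹) := by
  rw [endpointProd_eq hβ ht, endpointProd_eq hβ hs, add_sub_add_left_eq_sub,
    ← Finset.sum_sub_distrib, Finset.mul_sum]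
  refine Finset.sum_congr rfl fun k _ => ?_
  have := sub_ofReal_ne_zero ht (β k)
  have := sub_ofReal_ne_zero hs (β k)
  field_simp
  ring

/-- The imaginary part of each equation, divided by that of its solution, says that a weighted sum
of `|X j|²` is 1; the difference of the equations, divided by `t - s`, says the same of `X t j * X s
j`. So `X t j = conj (X s j)` for all `j`, which fails for an index where `(X t j)⁻¹` always lies in
the upper half plane. -/
lemma fixed_unique {T : Finset ι} {α β : ι → ℝ} (hI : DisjointIntervals T α β) (hT : T.Nonempty)
    {L : Finset κ} {c : κ → ℝ} (hc : ∀ l ∈ L, 0 < c l) (hne : 2 ≤ T.card ∨ L.Nonempty)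
    {C x : ℝ} (hx : 0 < x) {t s : ℂ} (ht : 0 < t.im) (hs : 0 < s.im)
    (htfix : t = C + x * slopeFun L c (endpointProd T α β t))
    (hsfix : s = C + x * slopeFun L c (endpointProd T α β s)) : t = s := by
  have hz : ∀ {t : ℂ}, 0 < t.im → (endpointProd T α β t).im < 0 :=
    fun ht => im_endpointProd_neg hI ht hT
  by_contra hts
  set W : ι × Option κ → ℝ := fun j => x * (residue T α β j.1 * slopeWeight c j.2)
  set X : ℂ → ι × Option κ → ℂ :=
    fun t j => (t - β j.1)⁻¹ * (slopeTerm c (endpointProd T α β t) j.2)⁻¹ with hX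
  have hnorm : ∀ t : ℂ, 0 < t.im → t = C + x * slopeFun L c (endpointProd T α β t) →
      ∑ j ∈ T ×ˢ Finset.insertNone L, W j * Complex.normSq (X t j) = 1 := by
    intro t ht hfix
    have h1 := congrArg Complex.im hfix
    rw [Complex.add_im, Complex.ofReal_im, zero_add, Complex.im_ofReal_mul,
      im_slopeFun hc (hz ht).ne, im_endpointProd hI.injOn_right ht.ne', neg_mul t.im, neg_neg,
      mul_assoc, mul_left_comm] at h1
    have h2 := mul_left_cancel₀ ht.ne' ((mul_one _).trans h1)
    rw [h2, Finset.sum_product]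
    have e : (Complex.normSq (endpointProd T α β t - 1))⁻¹ +
        ∑ l ∈ L, c l / Complex.normSq (1 + c l * endpointProd T α β t) =
        ∑ o ∈ Finset.insertNone L, slopeWeight c o /
          Complex.normSq (slopeTerm c (endpointProd T α β t) o) := by
      rw [Finset.sum_insertNone]
      simp [slopeWeight, slopeTerm]
    rw [e, Finset.sum_mul_sum, Finset.mul_sum]
    refine Finset.sum_congr rfl fun k _ => ?_
    rw [Finset.mul_sum]
    refine Finset.sum_congr rfl fun o _ => ?_
    simp only [W, hX, Complex.normSq_mul, Complex.normSq_inv]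
    ring
  have hcross : ∑ j ∈ T ×ˢ Finset.insertNone L, (W j : ℂ) * (X t j * X s j) = 1 := by
    have h1 : t - s = x * (slopeFun L c (endpointProd T α β t) -
        slopeFun L c (endpointProd T α β s)) := by
      linear_combination htfix - hsfix
    rw [slopeFun_sub hc (hz ht).ne (hz hs).ne, endpointProd_sub hI.injOn_right ht.ne' hs.ne',
      neg_mul (t - s), neg_neg, mul_assoc, mul_left_comm] at h1
    have h2 := mul_left_cancel₀ (sub_ne_zero.mpr hts) ((mul_one _).trans h1)
    rw [h2, Finset.sum_product, Finset.sum_mul_sum, Finset.mul_sum]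
    refine Finset.sum_congr rfl fun k _ => ?_
    rw [Finset.mul_sum]
    refine Finset.sum_congr rfl fun o _ => ?_
    simp only [W, hX]
    push_cast
    ring
  have hW : ∀ j ∈ T ×ˢ Finset.insertNone L, 0 < W j := by
    intro j hj
    rw [Finset.mem_product] at hj
    exact mul_pos hx (mul_pos (hI.residue_right_pos hj.1) (slopeWeight_pos hc _ hj.2))
  have key := eq_conj_of_sum_eq_one _ W (X t) (X s) hW (hnorm t ht htfix) (hnorm s hs hsfix) hcross
  obtain ⟨k, hk, hmax⟩ := T.exists_max_image β hT
  -- At the rightmost endpoint the term `z - 1` serves if there are two intervals, and a term `1 + c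
  -- l * z` serves otherwise.
  have hsign : ∃ o ∈ Finset.insertNone L, ∀ t : ℂ, 0 < t.im →
      0 < ((t - β k) * slopeTerm c (endpointProd T α β t) o).im := by
    rcases hne with h | ⟨l, hl⟩
    · exact ⟨none, by simp, fun t ht => im_sub_mul_right_pos hI ht hmax h⟩
    · refine ⟨some l, by simpa using hl, fun t ht => ?_⟩
      have e : (t - β k) * slopeTerm c (endpointProd T α β t) (some l) =
          (c l : ℂ) * ((t - β k) * (endpointProd T α β t - 1)) +
            ((1 + c l : ℝ) : ℂ) * (t - β k) := by
        simp only [slopeTerm]; push_cast; ring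
      have h1 := mul_nonneg (hc l hl).le (im_sub_mul_right_nonneg hI ht hmax)
      have h2 : 0 < (1 + c l) * t.im := mul_pos (by linarith [hc l hl]) ht
      have h3 : (t - (β k : ℂ)).im = t.im := by simp
      rw [e, Complex.add_im, Complex.im_ofReal_mul, Complex.im_ofReal_mul, h3]
      linarith
  obtain ⟨o, ho, hpos⟩ := hsign
  have h1 := key (k, o) (Finset.mem_product.mpr ⟨hk, ho⟩)
  simp only [hX, ← mul_inv, map_inv₀] at h1
  have h2 := congrArg Complex.im (inv_injective h1)
  rw [Complex.conj_im] at h2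
  linarith [hpos t ht, hpos s hs]

end Uniqueness

/-! ### From unique fixed points to a homeomorphism -/

section Homeomorphism

/-- Zeros of `z - C - x * G z` near an isolated one persist under small changes of `C` and `x`. -/
lemma eventually_exists_zero {G : ℂ → ℂ} (hG : DifferentiableOn ℂ G {t | 0 < t.im})
    {C₀ x₀ : ℝ} {t₀ : ℂ} {r : ℝ} (hr : 0 < r) (hball : Metric.closedBall t₀ r ⊆ {t | 0 < t.im})
    (h0 : t₀ = C₀ + x₀ * G t₀)
    (huniq : ∀ t : ℂ, 0 < t.im → t = C₀ + x₀ * G t → t = t₀) :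
    ∀ᶠ q in 𝓝 (C₀, x₀), ∃ t ∈ Metric.closedBall t₀ r, t = (q.1 : ℂ) + (q.2 : ℂ) * G t := by
  have hGc : ContinuousOn G (Metric.closedBall t₀ r) := hG.continuousOn.mono hball
  set g : ℝ × ℝ → ℂ → ℂ := fun q t => t - q.1 - q.2 * G t with hg
  have hgd : ∀ q, DifferentiableOn ℂ (g q) (Metric.closedBall t₀ r) := fun q =>
    (differentiableOn_id.sub_const _).sub ((hG.mono hball).const_mul _)
  obtain ⟨s, hs, hmin⟩ := (isCompact_sphere t₀ r).exists_isMinOn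
    (NormedSpace.sphere_nonempty.mpr hr.le)
    ((hgd (C₀, x₀)).continuousOn.norm.mono Metric.sphere_subset_closedBall)
  have hδ : 0 < ‖g (C₀, x₀) s‖ := by
    rw [norm_pos_iff]
    intro h
    have h1 := huniq s (hball (Metric.sphere_subset_closedBall hs)) (by
      simp only [hg] at h
      linear_combination h)
    rw [h1, Metric.mem_sphere, dist_self] at hs
    exact hr.ne hs
  set δ := ‖g (C₀, x₀) s‖
  obtain ⟨M, hM⟩ := (isCompact_closedBall t₀ r).exists_bound_of_continuousOn hGc
  have hlim : Tendsto (fun q : ℝ × ℝ => |q.1 - C₀| + |q.2 - x₀| * M) (𝓝 (C₀, x₀)) (𝓝 0) := by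
    have : Continuous (fun q : ℝ × ℝ => |q.1 - C₀| + |q.2 - x₀| * M) := by fun_prop
    simpa using this.tendsto (C₀, x₀)
  filter_upwards [hlim.eventually_lt_const (half_pos hδ)] with q hq
  have hclose : ∀ t ∈ Metric.closedBall t₀ r, ‖g q t - g (C₀, x₀) t‖ < δ / 2 := by
    intro t ht
    have e : g q t - g (C₀, x₀) t = -(((q.1 - C₀ : ℝ) : ℂ) + ((q.2 - x₀ : ℝ) : ℂ) * G t) := by
      simp only [hg]; push_cast; ring
    rw [e, norm_neg]
    refine lt_of_le_of_lt (norm_add_le _ _) (lt_of_le_of_lt ?_ hq)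
    rw [norm_mul, Complex.norm_real, Complex.norm_real, Real.norm_eq_abs, Real.norm_eq_abs]
    gcongr
    exact hM t ht
  -- Without a zero of `g q` in the ball, the maximum principle for `1 / g q` bounds it at `t₀` by
  -- its values on the sphere, where `|g q| ≥ δ / 2`; but `|g q t₀| < δ / 2`.
  by_contra! hcon
  have hne : ∀ t ∈ Metric.closedBall t₀ r, g q t ≠ 0 := fun t ht h => hcon t ht (by
    simp only [hg] at h
    linear_combination h)
  have hcl : closure (Metric.ball t₀ r) = Metric.closedBall t₀ r := closure_ball t₀ hr.ne'
  have hinv : DiffContOnCl ℂ (fun t => (g q t)⁻¹) (Metric.ball t₀ r) := by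
    refine DifferentiableOn.diffContOnCl ?_
    rw [hcl]
    exact (hgd q).inv hne
  have hmax := Complex.norm_le_of_forall_mem_frontier_norm_le Metric.isBounded_ball hinv
    (C := (δ / 2)⁻¹) (fun t ht => ?_) (subset_closure (Metric.mem_ball_self hr))
  · have h1 := hclose t₀ (Metric.mem_closedBall_self hr.le)
    have h2 : g (C₀, x₀) t₀ = 0 := by
      simp only [hg]
      linear_combination h0
    rw [h2, sub_zero] at h1
    rw [norm_inv] at hmax
    have h3 := norm_pos_iff.mpr (hne t₀ (Metric.mem_closedBall_self hr.le))
    exact absurd ((inv_le_inv₀ h3 (half_pos hδ)).mp hmax) (not_le.mpr h1)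
  · rw [frontier_ball _ hr.ne'] at ht
    have ht' := Metric.sphere_subset_closedBall ht
    have h1 := hclose t ht'
    have h2 : δ ≤ ‖g (C₀, x₀) t‖ := hmin ht
    have h3 := norm_sub_norm_le (g (C₀, x₀) t) (g q t)
    rw [norm_sub_rev (g (C₀, x₀) t)] at h3
    rw [norm_inv]
    exact inv_anti₀ (half_pos hδ) (by linarith)

/-- The imaginary part of the equation gives `p.2 = t.im / (G t).im` and the real part then gives
`p.1`: this is the continuous inverse `ψ`. The forward map is continuous because the zero that
persists near `f p` must, by uniqueness, be `f q`. -/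
theorem exists_homeomorph_fixed {G : ℂ → ℂ} (hG : DifferentiableOn ℂ G {t | 0 < t.im})
    (hpos : ∀ t : ℂ, 0 < t.im → 0 < (G t).im)
    (huniq : ∀ (C x : ℝ) (t s : ℂ), 0 < t.im → 0 < s.im → t = C + x * G t → s = C + x * G s → t = s)
    {n d : ℝ} (hn : n ≠ 0) {S : Set (ℝ × ℝ)}
    (hS : ∀ p : ℝ × ℝ, p ∈ S ↔
      ∃ t : ℂ, 0 < t.im ∧ t = ((n * p.1 + d * p.2 : ℝ) : ℂ) + (p.2 : ℂ) * G t) :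
    ∃ T : S ≃ₜ UpperHalfPlane, ∀ p : S,
      (T p : ℂ) = ((n * p.1.1 + d * p.1.2 : ℝ) : ℂ) + (p.1.2 : ℂ) * G (T p) := by
  choose f hf0 hf using fun p : S => (hS p.1).mp p.2
  set ψ : UpperHalfPlane → ℝ × ℝ := fun τ =>
    (((τ : ℂ).re - (τ : ℂ).im / (G τ).im * (G τ).re - d * ((τ : ℂ).im / (G τ).im)) / n,
      (τ : ℂ).im / (G τ).im) with hψ
  have hψfix : ∀ τ : UpperHalfPlane,
      (τ : ℂ) = ((n * (ψ τ).1 + d * (ψ τ).2 : ℝ) : ℂ) + ((ψ τ).2 : ℂ) * G τ := by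
    intro τ
    have h1 := (hpos τ τ.im_pos).ne'
    apply Complex.ext
    · rw [Complex.add_re, Complex.ofReal_re, Complex.re_ofReal_mul]
      simp only [hψ]
      field_simp
      ring
    · rw [Complex.add_im, Complex.ofReal_im, Complex.im_ofReal_mul]
      simp only [hψ]
      field_simp
      ring
  have hψS : ∀ τ, ψ τ ∈ S := fun τ => (hS _).mpr ⟨τ, τ.im_pos, hψfix τ⟩
  have hψf : ∀ p : S, ψ ⟨f p, hf0 p⟩ = p.1 := by
    intro p
    have h1 := hf p
    have h2 : ((p.1.2 : ℂ) * G (f p)).im = p.1.2 * (G (f p)).im := Complex.im_ofReal_mul _ _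
    have h3 := congrArg Complex.im h1
    rw [Complex.add_im, Complex.ofReal_im, h2, zero_add] at h3
    have h4 := congrArg Complex.re h1
    rw [Complex.add_re, Complex.ofReal_re, Complex.re_ofReal_mul] at h4
    have h5 : (f p).im / (G (f p)).im = p.1.2 := by
      rw [div_eq_iff (hpos _ (hf0 p)).ne', h3]
    refine Prod.ext ?_ h5
    change ((f p).re - (f p).im / (G (f p)).im * (G (f p)).re - d * ((f p).im / (G (f p)).im)) / n
      = p.1.1
    rw [h5, h4]
    field_simp
    ring
  have hGcont : Continuous fun τ : UpperHalfPlane => G τ :=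
    hG.continuousOn.comp_continuous UpperHalfPlane.continuous_coe fun τ => τ.im_pos
  have hψcont : Continuous ψ := by
    have h1 : ∀ τ : UpperHalfPlane, (G τ).im ≠ 0 := fun τ => (hpos τ τ.im_pos).ne'
    have h2 := Complex.continuous_re.comp hGcont
    have h3 := Complex.continuous_im.comp hGcont
    have h4 := Complex.continuous_re.comp UpperHalfPlane.continuous_coe
    have h5 := Complex.continuous_im.comp UpperHalfPlane.continuous_coe
    have h6 := h5.div h3 h1
    exact (((h4.sub (h6.mul h2)).sub (h6.const_mul d)).div_const n).prodMk h6
  have hfcont : Continuous f := by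
    rw [continuous_iff_continuousAt]
    intro p
    rw [ContinuousAt, Metric.tendsto_nhds]
    intro ε hε
    obtain ⟨r, hr, hrε, hrim⟩ : ∃ r, 0 < r ∧ r < ε ∧ r < (f p).im := by
      obtain ⟨r, hr, hr2⟩ := exists_between (lt_min hε (hf0 p))
      exact ⟨r, hr, lt_of_lt_of_le hr2 (min_le_left _ _), lt_of_lt_of_le hr2 (min_le_right _ _)⟩
    have hball : Metric.closedBall (f p) r ⊆ {t | 0 < t.im} := by
      intro t ht
      rw [Metric.mem_closedBall, dist_eq_norm] at ht
      have h1 := (Complex.abs_im_le_norm (t - f p)).trans ht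
      rw [Complex.sub_im, abs_le] at h1
      change 0 < t.im
      linarith [h1.1]
    have h1 := eventually_exists_zero hG hr hball (hf p)
      (fun t ht htf => huniq _ _ _ _ ht (hf0 p) htf (hf p))
    have h2 : Continuous fun q : S => (n * q.1.1 + d * q.1.2, q.1.2) := by fun_prop
    filter_upwards [(h2.tendsto p).eventually h1] with q hq
    obtain ⟨t, ht, htf⟩ := hq
    rw [huniq _ _ _ _ (hf0 q) (hball ht) (hf q) htf]
    exact lt_of_le_of_lt ht hrε
  refine ⟨{ toFun := fun p => ⟨f p, hf0 p⟩
            invFun := fun τ => ⟨ψ τ, hψS τ⟩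
            left_inv := fun p => Subtype.ext (hψf p)
            right_inv := fun τ => UpperHalfPlane.ext
              (huniq _ _ _ _ (hf0 _) τ.im_pos (hf ⟨ψ τ, hψS τ⟩) (hψfix τ))
            continuous_toFun := ?_
            continuous_invFun := hψcont.subtype_mk _ }, fun p => hf p⟩
  exact UpperHalfPlane.isEmbedding_coe.continuous_iff.mpr hfcont

end Homeomorphism

/-! ### The Stieltjes transform of a union of intervals -/

section StieltjesTransform

variable {ι : Type*}

/-- Lebesgue measure on the intervals `[α k, β k]`, `k ∈ T`. -/
noncomputable def intervalMeasure (T : Finset ι) (α β : ι → ℝ) : Measure ℝ :=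
  ∑ k ∈ T, volume.restrict (Set.Icc (α k) (β k))

lemma continuous_stieltjesKernel {t : ℂ} (ht : t.im ≠ 0) :
    Continuous fun u : ℝ => 1 / (t - (u : ℂ)) :=
  continuous_const.div (continuous_const.sub Complex.continuous_ofReal)
    fun u => sub_ofReal_ne_zero ht u

lemma integral_intervalMeasure {E : Type*} [NormedAddCommGroup E] [NormedSpace ℝ E]
    (T : Finset ι) (α β : ι → ℝ) {f : ℝ → E} (hf : Continuous f) :
    ∫ u, f u ∂(intervalMeasure T α β) = ∑ k ∈ T, ∫ u in Set.Icc (α k) (β k), f u :=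
  integral_finsetSum_measure fun _ _ => hf.continuousOn.integrableOn_Icc

lemma integral_stieltjesKernel {t : ℂ} (ht : t.im ≠ 0) {a b : ℝ} (hab : a ≤ b) :
    ∫ u in Set.Icc a b, 1 / (t - (u : ℂ)) = Complex.log (t - a) - Complex.log (t - b) := by
  rw [integral_Icc_eq_integral_Ioc, ← intervalIntegral.integral_of_le hab]
  have hd : ∀ u ∈ Set.uIcc a b,
      HasDerivAt (fun u : ℝ => -Complex.log (t - u)) (1 / (t - (u : ℂ))) u := by
    intro u _
    have h1 : t - (u : ℂ) ∈ Complex.slitPlane := by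
      rw [Complex.mem_slitPlane_iff]
      right
      simpa using ht
    have h2 : HasDerivAt (fun u : ℝ => t - (u : ℂ)) (-1) u :=
      (Complex.ofRealCLM.hasDerivAt (x := u)).const_sub t
    have h3 := (h2.clog_real h1).neg
    refine h3.congr_deriv ?_
    ring
  rw [intervalIntegral.integral_eq_sub_of_hasDerivAt hd
    ((continuous_stieltjesKernel ht).intervalIntegrable _ _)]
  ring

lemma stieltjes_conj (m : Measure ℝ) (t : ℂ) : stieltjes m (conj t) = conj (stieltjes m t) := by
  rw [stieltjes, stieltjes, ← integral_conj]
  simp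

lemma exp_stieltjes_intervalMeasure {T : Finset ι} {α β : ι → ℝ} (hlt : ∀ k ∈ T, α k < β k) {t : ℂ}
    (ht : t.im ≠ 0) :
    Complex.exp (stieltjes (intervalMeasure T α β) t) = endpointProd T α β t := by
  rw [stieltjes, integral_intervalMeasure T α β (continuous_stieltjesKernel ht), Complex.exp_sum]
  refine Finset.prod_congr rfl fun k hk => ?_
  rw [integral_stieltjesKernel ht (hlt k hk).le, Complex.exp_sub,
    Complex.exp_log (sub_ofReal_ne_zero ht _), Complex.exp_log (sub_ofReal_ne_zero ht _)]

lemma im_stieltjesKernel (t : ℂ) (u : ℝ) :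
    (1 / (t - (u : ℂ))).im = -(t.im / Complex.normSq (t - u)) := by
  rw [one_div, Complex.inv_im]
  simp
  ring

lemma intervalMeasure_le [DecidableEq ι] {T : Finset ι} {α β : ι → ℝ}
    (hI : DisjointIntervals T α β) {a b : ℝ} (ha : ∀ k ∈ T, a ≤ α k) (hb : ∀ k ∈ T, β k ≤ b) :
    intervalMeasure T α β ≤ volume.restrict (Set.Icc a b) := by
  have h : intervalMeasure T α β = volume.restrict (⋃ k ∈ T, Set.Icc (α k) (β k)) := by
    rw [Measure.restrict_biUnion_finset (fun j hj k hk hjk => ?_) fun k => measurableSet_Icc,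
      Measure.sum_fintype, intervalMeasure, ← Finset.sum_coe_sort]
    rw [Function.onFun, Set.disjoint_left]
    rintro x ⟨h1, h2⟩ ⟨h3, h4⟩
    rcases hI.sep j hj k hk hjk with h5 | h5 <;> linarith
  rw [h]
  refine Measure.restrict_mono (Set.iUnion₂_subset fun k hk => ?_) le_rfl
  exact Set.Icc_subset_Icc (ha k hk) (hb k hk)

/-- The imaginary part of the integrand has constant sign, so the integral is compared with the one
over the convex hull `[a, b]`, where it is `arg (t - a) - arg (t - b) > -π`. This keeps `St` in the
strip where the principal logarithm inverts `exp`. -/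
lemma im_stieltjes_mem [DecidableEq ι] {T : Finset ι} {α β : ι → ℝ} (hI : DisjointIntervals T α β)
    {t : ℂ} (ht : 0 < t.im) :
    -Real.pi < (stieltjes (intervalMeasure T α β) t).im ∧
      (stieltjes (intervalMeasure T α β) t).im ≤ 0 := by
  have hcont := continuous_stieltjesKernel ht.ne'
  rcases T.eq_empty_or_nonempty with rfl | hT
  · simp [stieltjes, intervalMeasure, Real.pi_pos]
  obtain ⟨j, hj, hmin⟩ := T.exists_min_image α hT
  obtain ⟨k, hk, hmax⟩ := T.exists_max_image β hT
  have hle := intervalMeasure_le hI hmin hmax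
  have hjk : α j ≤ β k := (hI.lt j hj).le.trans (hmax j hj)
  have hint : Integrable (fun u : ℝ => 1 / (t - (u : ℂ)))
      (volume.restrict (Set.Icc (α j) (β k))) := hcont.continuousOn.integrableOn_Icc
  have hnn : ∀ u : ℝ, 0 ≤ -(1 / (t - (u : ℂ))).im := fun u => by
    rw [im_stieltjesKernel, neg_neg]
    exact div_nonneg ht.le (Complex.normSq_nonneg _)
  have him : ∀ μ : Measure ℝ, Integrable (fun u : ℝ => 1 / (t - (u : ℂ))) μ →
      ∫ u : ℝ, -(1 / (t - (u : ℂ))).im ∂μ = -(∫ u : ℝ, 1 / (t - (u : ℂ)) ∂μ).im := by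
    intro μ hμ
    rw [integral_neg]
    exact congrArg Neg.neg (integral_im hμ)
  have h1 : ∫ u : ℝ, -(1 / (t - (u : ℂ))).im ∂(intervalMeasure T α β) ≤
      ∫ u in Set.Icc (α j) (β k), -(1 / (t - (u : ℂ))).im :=
    integral_mono_measure hle (Eventually.of_forall hnn) hint.im.neg
  have h2 : 0 ≤ ∫ u : ℝ, -(1 / (t - (u : ℂ))).im ∂(intervalMeasure T α β) := integral_nonneg hnn
  rw [him _ (hint.mono_measure hle), him _ hint, integral_stieltjesKernel ht.ne' hjk,
    Complex.sub_im, Complex.log_im, Complex.log_im] at h1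
  rw [him _ (hint.mono_measure hle)] at h2
  have h3 : Complex.arg (t - (β k : ℂ)) ≤ Real.pi := Complex.arg_le_pi _
  have h4 : 0 < Complex.arg (t - (α j : ℂ)) := by
    have : 0 < (t - (α j : ℂ)).im := by simpa using ht
    refine lt_of_le_of_ne (Complex.arg_nonneg_iff.mpr this.le) fun h => ?_
    exact this.ne' (Complex.arg_eq_zero_iff.mp h.symm).2
  rw [stieltjes]
  constructor <;> linarith

lemma log_exp_stieltjes [DecidableEq ι] {T : Finset ι} {α β : ι → ℝ} (hI : DisjointIntervals T α β)
    {t : ℂ} (ht : t.im ≠ 0) :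
    Complex.log (Complex.exp (stieltjes (intervalMeasure T α β) t)) =
      stieltjes (intervalMeasure T α β) t := by
  have hpi := Real.pi_pos
  rcases ht.lt_or_gt with h | h
  · have h1 := im_stieltjes_mem hI (t := conj t) (by rw [Complex.conj_im]; linarith)
    rw [stieltjes_conj, Complex.conj_im] at h1
    exact Complex.log_exp (by linarith) (by linarith)
  · have h1 := im_stieltjes_mem hI h
    exact Complex.log_exp (by linarith) (by linarith)

/-- Conjugation symmetry also covers real `t` at which the integral diverges and has the default
value 0. Hence a real `t` never accompanies a non-real root. -/
lemma im_stieltjes_of_im_eq_zero (m : Measure ℝ) {t : ℂ} (ht : t.im = 0) :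
    (stieltjes m t).im = 0 := by
  have h := stieltjes_conj m t
  rw [Complex.conj_eq_iff_im.mpr ht] at h
  exact Complex.conj_eq_iff_im.mp h.symm

lemma endpointProd_conj (T : Finset ι) (α β : ι → ℝ) (t : ℂ) :
    endpointProd T α β (conj t) = conj (endpointProd T α β t) := by
  simp [endpointProd]

lemma slopeFun_conj {κ : Type*} (L : Finset κ) (c : κ → ℝ) (z : ℂ) :
    slopeFun L c (conj z) = conj (slopeFun L c z) := by
  simp [slopeFun]

end StieltjesTransform

/-! ### The root equation as a fixed-point equation -/

section Roots

variable {n : ℕ} [NeZero n]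

/-- The set of indices that contribute to `A_i`. -/
def activeIndices (I₂ : Finset (Fin n)) (i : Fin n) : Finset (Fin n) := if i = 0 then I₂ else ∅

/-- The terms in `log z` cancel, so the branch enters only through `t`, and linearly. -/
lemma derivH_eq (z t : ℂ) : derivH z t = t / z - 1 / (z - 1) := by
  simp only [derivH, rTransform]
  ring

/-- The two coefficients of `z / (z - 1)` add up to `-κ / (n (1 - κ))`, so multiplication by `n (1 -
κ)` leaves an affine relation between `t`, `χ` and `κ`. -/
lemma funF_eq_iff (x₁ : ℝ) (I₂ : Finset (Fin n)) (y : Fin n → ℝ) (i : Fin n) {χ κ : ℝ} (hκ : κ < 1)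
    {z t : ℂ} (hz : z ≠ 0) (hz1 : z - 1 ≠ 0) :
    funF x₁ I₂ y i κ z t = (χ : ℂ) / (1 - (κ : ℂ)) ↔
      t = (((n : ℝ) * χ + ((n : ℝ) - ((i : ℕ) + 1)) * κ : ℝ) : ℂ) +
        κ * slopeFun (activeIndices I₂ i) (fun l => y l * x₁) z := by
  have hn : (n : ℂ) ≠ 0 := Nat.cast_ne_zero.mpr (NeZero.ne n)
  have hκ' : (1 : ℂ) - κ ≠ 0 := by
    rw [← Complex.ofReal_one, ← Complex.ofReal_sub, Complex.ofReal_ne_zero]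
    linarith
  have hsum : ∑ l ∈ activeIndices I₂ i, (((y l * x₁ : ℝ) : ℂ) * z) / (1 + ((y l * x₁ : ℝ) : ℂ) * z)
      = z * (if i = 0 then ∑ l ∈ I₂, ((y l : ℂ) * x₁) / (1 + (y l : ℂ) * x₁ * z) else 0) := by
    rw [activeIndices]
    split_ifs
    · rw [Finset.mul_sum]
      refine Finset.sum_congr rfl fun l _ => ?_
      push_cast
      ring
    · simp
  have hcoeff : coeffA x₁ I₂ y i κ z t = ((κ : ℂ) / n) *
      (if i = 0 then ∑ l ∈ I₂, ((y l : ℂ) * x₁) / (1 + (y l : ℂ) * x₁ * z) else 0)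
      - ((κ : ℂ) / n) * (((n : ℂ) - ((i : ℕ) + 1)) / z) + (1 / (n : ℂ)) * (t / z - 1 / (z - 1)) := by
    rw [coeffA, derivH_eq]
    split_ifs <;> simp
  rw [slopeFun, hsum, funF, hcoeff, ← sub_eq_zero, ← sub_eq_zero (a := t)]
  generalize (if i = 0 then ∑ l ∈ I₂, ((y l : ℂ) * x₁) / (1 + (y l : ℂ) * x₁ * z) else 0) = S
  have e : (1 / (n : ℂ)) * (z / (z - 1)) + (1 / (1 - (κ : ℂ))) * (z * (((κ : ℂ) / n) * S
      - ((κ : ℂ) / n) * (((n : ℂ) - ((i : ℕ) + 1)) / z) + (1 / (n : ℂ)) * (t / z - 1 / (z - 1))))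
      - (χ : ℂ) / (1 - (κ : ℂ)) = (t - ((((n : ℝ) * χ + ((n : ℝ) - ((i : ℕ) + 1)) * κ : ℝ) : ℂ) +
        κ * (z / (z - 1) - z * S))) / (n * (1 - (κ : ℂ))) := by
    push_cast
    field_simp
    ring
  rw [e, div_eq_zero_iff, or_iff_left (mul_ne_zero hn hκ')]

variable {ι : Type*} [DecidableEq ι] {T : Finset ι} {α β : ι → ℝ}

lemma im_ne_zero_of_isRoot {m : Measure ℝ} {x₁ : ℝ} {I₂ : Finset (Fin n)} {y : Fin n → ℝ}
    {i : Fin n} {χ κ : ℝ} {z t : ℂ} (h : IsRoot m x₁ I₂ y i χ κ z t) : t.im ≠ 0 := by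
  intro ht
  have h1 := im_stieltjes_of_im_eq_zero m ht
  rw [h.2.1, Complex.log_im] at h1
  exact h.1 (Complex.arg_eq_zero_iff.mp h1).2

/-- Choosing the root `z` in the lower half plane thus amounts to choosing `t` in the upper one. -/
lemma im_endpointProd_mul_neg (hI : DisjointIntervals T α β) (hT : T.Nonempty) {t : ℂ}
    (ht : t.im ≠ 0) : (endpointProd T α β t).im * t.im < 0 := by
  rw [im_endpointProd hI.injOn_right ht]
  have : 0 < ∑ k ∈ T, residue T α β k / Complex.normSq (t - β k) :=
    Finset.sum_pos (fun k hk => div_pos (hI.residue_right_pos hk) (normSq_sub_pos ht _)) hT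
  have h2 : 0 < t.im ^ 2 := by positivity
  nlinarith [mul_pos h2 this]

lemma isRoot_iff (hI : DisjointIntervals T α β) (hT : T.Nonempty) (x₁ : ℝ) (I₂ : Finset (Fin n))
    (y : Fin n → ℝ) (i : Fin n) {χ κ : ℝ} (hκ : κ < 1) {z t : ℂ} (ht : t.im ≠ 0) :
    IsRoot (intervalMeasure T α β) x₁ I₂ y i χ κ z t ↔ z = endpointProd T α β t ∧
      t = (((n : ℝ) * χ + ((n : ℝ) - ((i : ℕ) + 1)) * κ : ℝ) : ℂ) +
        κ * slopeFun (activeIndices I₂ i) (fun l => y l * x₁) (endpointProd T α β t) := by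
  have him : (endpointProd T α β t).im ≠ 0 :=
    left_ne_zero_of_mul (im_endpointProd_mul_neg hI hT ht).ne
  have hz0 := endpointProd_ne_zero T α β ht
  have hexp := exp_stieltjes_intervalMeasure hI.lt ht
  constructor
  · rintro ⟨h1, h2, h3⟩
    have hz : z ≠ 0 := by
      rintro rfl
      exact h1 rfl
    have h4 : z = endpointProd T α β t := by
      rw [← hexp, h2, Complex.exp_log hz]
    refine ⟨h4, ?_⟩
    rw [← h4]
    exact (funF_eq_iff x₁ I₂ y i hκ hz (sub_one_ne_zero_of_im h1)).mp h3
  · rintro ⟨rfl, h⟩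
    refine ⟨him, ?_, (funF_eq_iff x₁ I₂ y i hκ hz0 (sub_one_ne_zero_of_im him)).mpr h⟩
    rw [← hexp, log_exp_stieltjes hI ht]

lemma isRoot_conj (hI : DisjointIntervals T α β) (hT : T.Nonempty) {x₁ : ℝ} {I₂ : Finset (Fin n)}
    {y : Fin n → ℝ} {i : Fin n} {χ κ : ℝ} (hκ : κ < 1) {z t : ℂ}
    (h : IsRoot (intervalMeasure T α β) x₁ I₂ y i χ κ z t) :
    IsRoot (intervalMeasure T α β) x₁ I₂ y i χ κ (conj z) (conj t) := by
  have ht := im_ne_zero_of_isRoot h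
  have ht' : (conj t).im ≠ 0 := by rw [Complex.conj_im]; exact neg_ne_zero.mpr ht
  obtain ⟨h1, h2⟩ := (isRoot_iff hI hT x₁ I₂ y i hκ ht).mp h
  refine (isRoot_iff hI hT x₁ I₂ y i hκ ht').mpr ⟨?_, ?_⟩
  · rw [endpointProd_conj, ← h1]
  · rw [endpointProd_conj, slopeFun_conj]
    have h3 := congrArg conj h2
    rw [map_add, map_mul, Complex.conj_ofReal, Complex.conj_ofReal] at h3
    exact h3

end Roots

/-! ### The region `𝒮_i` and its parametrization -/

section FrozenRegion

lemma weight_pos_of_mem_activeIndices {n : ℕ} [NeZero n] {I₂ : Finset (Fin n)} {y : Fin n → ℝ}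
    {x₁ : ℝ} (hx₁ : 0 < x₁) (hy : ∀ l ∈ I₂, 0 < y l) {i : Fin n} :
    ∀ l ∈ activeIndices I₂ i, 0 < y l * x₁ := by
  intro l hl
  refine mul_pos (hy l ?_) hx₁
  rw [activeIndices] at hl
  split_ifs at hl
  · exact hl
  · simp at hl

variable {n s : ℕ} [NeZero n] [NeZero s] {ι : Type*} [DecidableEq ι] {T : Finset ι} {α β : ι → ℝ}

lemma differentiableOn_slopeFun_endpointProd {κ : Type*} {L : Finset κ} {c : κ → ℝ}
    (hI : DisjointIntervals T α β) (hT : T.Nonempty) (hc : ∀ l ∈ L, 0 < c l) :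
    DifferentiableOn ℂ (fun t => slopeFun L c (endpointProd T α β t)) {t | 0 < t.im} := by
  intro t (ht : 0 < t.im)
  refine DifferentiableAt.differentiableWithinAt ?_
  have h1 : DifferentiableAt ℂ (endpointProd T α β) t := by
    have : endpointProd T α β = fun t => ∏ k ∈ T, (t - (α k : ℂ)) / (t - β k) := rfl
    rw [this]
    exact DifferentiableAt.fun_finsetProd fun k _ => DifferentiableAt.div (by fun_prop) (by fun_prop)
      (sub_ofReal_ne_zero ht.ne' _)
  have h2 := (im_endpointProd_neg hI ht hT).ne
  refine DifferentiableAt.sub (h1.div (h1.sub_const 1) (sub_one_ne_zero_of_im h2)) ?_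
  exact DifferentiableAt.fun_sum fun l hl => (h1.const_mul _).div ((h1.const_mul _).const_add 1)
    (one_add_mul_ne_zero h2 (hc l hl))

/-- Non-real solutions of the fixed-point equation lie over the region `𝒮_i`, and conversely. -/
lemma mem_regionS_iff (hI : DisjointIntervals T α β) (hsum : ∑ k ∈ T, (β k - α k) = 1)
    {x₁ : ℝ} (hx₁ : 0 < x₁) {I₂ : Finset (Fin n)} {y : Fin n → ℝ} (hy : ∀ l ∈ I₂, 0 < y l)
    {a b : Fin s → ℝ} {i : Fin n} (hne : 2 ≤ T.card ∨ (i = 0 ∧ I₂.Nonempty))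
    (ha : ∀ k ∈ T, (n : ℝ) * a 0 + ((n : ℝ) - ((i : ℕ) + 1)) ≤ α k)
    (hb : ∀ k ∈ T, β k ≤ (n : ℝ) * b (Fin.rev 0) - (i : ℕ)) (p : ℝ × ℝ) :
    p ∈ regionS (intervalMeasure T α β) x₁ I₂ y a b i ↔ ∃ t : ℂ, 0 < t.im ∧
      t = (((n : ℝ) * p.1 + ((n : ℝ) - ((i : ℕ) + 1)) * p.2 : ℝ) : ℂ) + (p.2 : ℂ) *
        slopeFun (activeIndices I₂ i) (fun l => y l * x₁) (endpointProd T α β t) := by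
  have hT := nonempty_of_sum_eq_one hsum
  have hc := weight_pos_of_mem_activeIndices hx₁ hy (i := i)
  have hne' : 2 ≤ T.card ∨ (activeIndices I₂ i).Nonempty :=
    hne.imp_right fun h => by rw [activeIndices, if_pos h.1]; exact h.2
  constructor
  · rintro ⟨hp, z, -, hz⟩
    obtain ⟨t, ht⟩ : z ∈ {z : ℂ | ∃ t, IsRoot (intervalMeasure T α β) x₁ I₂ y i p.1 p.2 z t} := by
      rw [hz]; simp
    have him := im_ne_zero_of_isRoot ht
    rcases him.lt_or_gt with h | h
    · have hpos : 0 < (conj t).im := by rw [Complex.conj_im]; linarith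
      exact ⟨conj t, hpos,
        ((isRoot_iff hI hT x₁ I₂ y i hp.2.1 hpos.ne').mp (isRoot_conj hI hT hp.2.1 ht)).2⟩
    · exact ⟨t, h, ((isRoot_iff hI hT x₁ I₂ y i hp.2.1 him).mp ht).2⟩
  · rintro ⟨t, ht, hfix⟩
    have hlt := im_lt_im_slopeFun hI hsum hc hne' ht
    have him := congrArg Complex.im hfix
    rw [Complex.add_im, Complex.ofReal_im, zero_add, Complex.im_ofReal_mul] at him
    have hGpos := ht.trans hlt
    have hκ0 : 0 < p.2 := by
      by_contra! h
      exact absurd him.le (not_le.mpr (lt_of_le_of_lt (mul_nonpos_of_nonpos_of_nonneg h hGpos.le) ht))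
    have hκ1 : p.2 < 1 := by
      by_contra! h
      have := mul_le_mul_of_nonneg_right h hGpos.le
      linarith
    obtain ⟨j, hj, hmin⟩ := T.exists_min_image α hT
    obtain ⟨k, hk, hmax⟩ := T.exists_max_image β hT
    have hlow := lt_of_fixed hI hsum hc hne' ht hmin hκ0 hfix
    have hup := fixed_lt hI hsum hc hne' ht hmax hκ0 hfix
    have hn : (0 : ℝ) < n := Nat.cast_pos.mpr (NeZero.pos n)
    have hin : ((i : ℕ) : ℝ) + 1 ≤ n := by exact_mod_cast i.isLt
    -- The other classes leave room `n - (i + 1)` below and `i` above the intervals; as `κ < 1`,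
    -- these absorb `(n - (i + 1)) * κ` and `i * κ` in the two bounds on `χ`.
    refine ⟨⟨hκ0.le, hκ1, ?_, ?_⟩, endpointProd T α β t, ?_, ?_⟩
    · have h1 := ha j hj
      have h2 : ((n : ℝ) - ((i : ℕ) + 1)) * p.2 ≤ (n : ℝ) - ((i : ℕ) + 1) :=
        mul_le_of_le_one_right (by linarith) hκ1.le
      exact lt_of_mul_lt_mul_left (by linarith) hn.le
    · have h1 := hb k hk
      have h2 : ((activeIndices I₂ i).card : ℝ) * p.2 + (i : ℕ) * p.2 ≤ I₂.card * p.2 + (i : ℕ) := by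
        have h3 : ((i : ℕ) : ℝ) * p.2 ≤ (i : ℕ) :=
          mul_le_of_le_one_right (Nat.cast_nonneg _) hκ1.le
        have h4 : ((activeIndices I₂ i).card : ℝ) ≤ I₂.card := by
          rw [activeIndices]
          split_ifs
          · exact le_rfl
          · simp
        have h5 := mul_le_mul_of_nonneg_right h4 hκ0.le
        linarith
      refine lt_of_mul_lt_mul_left (a := (n : ℝ)) ?_ hn.le
      have e : (n : ℝ) * (b (Fin.rev 0) + ((I₂.card : ℝ) / n - 1) * p.2) =
          n * b (Fin.rev 0) + I₂.card * p.2 - n * p.2 := by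
        field_simp
        ring
      rw [e]
      linarith
    · exact (im_endpointProd_neg hI ht hT).ne
    · have hroot := (isRoot_iff hI hT x₁ I₂ y i hκ1 ht.ne').mpr ⟨rfl, hfix⟩
      apply Set.Subset.antisymm
      · rintro z ⟨t', ht'⟩
        have him' := im_ne_zero_of_isRoot ht'
        rcases him'.lt_or_gt with h | h
        · have hpos : 0 < (conj t').im := by rw [Complex.conj_im]; linarith
          obtain ⟨h1, h2⟩ := (isRoot_iff hI hT x₁ I₂ y i hκ1 hpos.ne').mp (isRoot_conj hI hT hκ1 ht')
          rw [fixed_unique hI hT hc hne' hκ0 hpos ht h2 hfix] at h1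
          right
          rw [Set.mem_singleton_iff, ← h1, Complex.conj_conj]
        · obtain ⟨h1, h2⟩ := (isRoot_iff hI hT x₁ I₂ y i hκ1 him').mp ht'
          rw [fixed_unique hI hT hc hne' hκ0 h ht h2 hfix] at h1
          left
          exact h1
      · rintro z (rfl | rfl)
        · exact ⟨t, hroot⟩
        · exact ⟨conj t, isRoot_conj hI hT hκ1 hroot⟩

omit [DecidableEq ι] in
lemma funQ_intervalMeasure (hI : DisjointIntervals T α β) {t : ℂ} (ht : t.im ≠ 0) :
    funQ (intervalMeasure T α β) t = endpointProd T α β t / (endpointProd T α β t - 1) := by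
  rw [funQ, exp_stieltjes_intervalMeasure hI.lt ht]

omit [DecidableEq ι] in
lemma slopeFun_activeIndices_zero (hI : DisjointIntervals T α β) (x₁ : ℝ) (I₂ : Finset (Fin n))
    (y : Fin n → ℝ) {t : ℂ} (ht : t.im ≠ 0) :
    slopeFun (activeIndices I₂ 0) (fun l => y l * x₁) (endpointProd T α β t) =
      funQ (intervalMeasure T α β) t - funP (intervalMeasure T α β) x₁ I₂ y t := by
  rw [funQ_intervalMeasure hI ht, funP, exp_stieltjes_intervalMeasure hI.lt ht, slopeFun,
    activeIndices, if_pos rfl]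
  simp

omit [DecidableEq ι] in
lemma slopeFun_activeIndices_of_ne_zero (hI : DisjointIntervals T α β) (x₁ : ℝ)
    (I₂ : Finset (Fin n)) (y : Fin n → ℝ) {i : Fin n} (hi : i ≠ 0) {t : ℂ} (ht : t.im ≠ 0) :
    slopeFun (activeIndices I₂ i) (fun l => y l * x₁) (endpointProd T α β t) =
      funQ (intervalMeasure T α β) t := by
  rw [funQ_intervalMeasure hI ht, slopeFun, activeIndices, if_neg hi]
  simp

theorem exists_homeomorph_regionS (hI : DisjointIntervals T α β)
    (hsum : ∑ k ∈ T, (β k - α k) = 1)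
    {x₁ : ℝ} (hx₁ : 0 < x₁) {I₂ : Finset (Fin n)} {y : Fin n → ℝ} (hy : ∀ l ∈ I₂, 0 < y l)
    {a b : Fin s → ℝ} {i : Fin n} (hne : 2 ≤ T.card ∨ (i = 0 ∧ I₂.Nonempty))
    (ha : ∀ k ∈ T, (n : ℝ) * a 0 + ((n : ℝ) - ((i : ℕ) + 1)) ≤ α k)
    (hb : ∀ k ∈ T, β k ≤ (n : ℝ) * b (Fin.rev 0) - (i : ℕ)) {m : Measure ℝ}
    (hm : m = intervalMeasure T α β) :
    ∃ T : regionS m x₁ I₂ y a b i ≃ₜ UpperHalfPlane,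
      (∀ p : regionS m x₁ I₂ y a b i,
        (∃ z : ℂ, z.im < 0 ∧ IsRoot m x₁ I₂ y i p.1.1 p.1.2 z (T p : ℂ)) ∧
        ∀ z t : ℂ, z.im < 0 → IsRoot m x₁ I₂ y i p.1.1 p.1.2 z t → t = (T p : ℂ)) ∧
      (i = 0 → ∀ τ : UpperHalfPlane, ∀ t : ℂ, t = (τ : ℂ) →
        funP m x₁ I₂ y t - funP m x₁ I₂ y (conj t) - funQ m t + funQ m (conj t) ≠ 0 ∧
        (((T.symm τ).1.1 : ℝ) : ℂ) =
          (conj t * (funP m x₁ I₂ y t - funQ m t)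
              - t * (funP m x₁ I₂ y (conj t) - funQ m (conj t)) - ((n : ℂ) - 1) * (conj t - t)) /
            ((n : ℂ) * (funP m x₁ I₂ y t - funP m x₁ I₂ y (conj t)
              - funQ m t + funQ m (conj t))) ∧
        (((T.symm τ).1.2 : ℝ) : ℂ) =
          (conj t - t) /
            (funP m x₁ I₂ y t - funP m x₁ I₂ y (conj t) - funQ m t + funQ m (conj t))) ∧
      (i ≠ 0 → ∀ τ : UpperHalfPlane, ∀ t : ℂ, t = (τ : ℂ) →
        funQ m t - funQ m (conj t) ≠ 0 ∧
        (((T.symm τ).1.1 : ℝ) : ℂ) =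
          (conj t * funQ m t - t * funQ m (conj t)
              + (conj t - t) * ((n : ℂ) - ((i : ℕ) + 1))) /
            ((n : ℂ) * (funQ m t - funQ m (conj t))) ∧
        (((T.symm τ).1.2 : ℝ) : ℂ) = (conj t - t) / (-funQ m t + funQ m (conj t))) := by
  subst hm
  have hT := nonempty_of_sum_eq_one hsum
  have hc := weight_pos_of_mem_activeIndices hx₁ hy (i := i)
  have hne' : 2 ≤ T.card ∨ (activeIndices I₂ i).Nonempty :=
    hne.imp_right fun h => by rw [activeIndices, if_pos h.1]; exact h.2
  set G : ℂ → ℂ := fun t =>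
    slopeFun (activeIndices I₂ i) (fun l => y l * x₁) (endpointProd T α β t) with hG
  have hGpos : ∀ t : ℂ, 0 < t.im → 0 < (G t).im := fun t ht =>
    ht.trans (im_lt_im_slopeFun hI hsum hc hne' ht)
  have hGconj : ∀ t, G (conj t) = conj (G t) := fun t => by
    simp only [hG]
    rw [endpointProd_conj, slopeFun_conj]
  have huniq : ∀ (C x : ℝ) (t s : ℂ), 0 < t.im → 0 < s.im → t = C + x * G t → s = C + x * G s →
      t = s := by
    intro C x t s ht hs htf hsf
    refine fixed_unique hI hT hc hne' ?_ ht hs htf hsf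
    have him := congrArg Complex.im htf
    rw [Complex.add_im, Complex.ofReal_im, zero_add, Complex.im_ofReal_mul] at him
    by_contra! h
    have := mul_nonpos_of_nonpos_of_nonneg h (hGpos t ht).le
    linarith
  have hn : (n : ℝ) ≠ 0 := Nat.cast_ne_zero.mpr (NeZero.ne n)
  have hnC : (n : ℂ) ≠ 0 := Nat.cast_ne_zero.mpr (NeZero.ne n)
  obtain ⟨F, hF⟩ := exists_homeomorph_fixed (differentiableOn_slopeFun_endpointProd hI hT hc)
    hGpos huniq hn (mem_regionS_iff hI hsum hx₁ hy hne ha hb)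
  refine ⟨F, fun p => ⟨?_, ?_⟩, ?_, ?_⟩
  · have him : 0 < (F p : ℂ).im := (F p).im_pos
    exact ⟨endpointProd T α β (F p), im_endpointProd_neg hI him hT,
      (isRoot_iff hI hT x₁ I₂ y i p.2.1.2.1 him.ne').mpr ⟨rfl, hF p⟩⟩
  · intro z t hz hroot
    have ht := im_ne_zero_of_isRoot hroot
    obtain ⟨h1, h2⟩ := (isRoot_iff hI hT x₁ I₂ y i p.2.1.2.1 ht).mp hroot
    have h3 := im_endpointProd_mul_neg hI hT ht
    rw [← h1] at h3
    exact huniq _ _ _ _ (pos_of_mul_neg_right h3 hz.le) (F p).im_pos h2 (hF p)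
  -- The equation and its conjugate form a linear system for `χ` and `κ`, whose determinant is a
  -- nonzero multiple of `G t - G (conj t)`.
  all_goals
    intro hi τ t htτ
    have ht : 0 < t.im := by rw [htτ]; exact τ.im_pos
    have ht' : (conj t).im ≠ 0 := by rw [Complex.conj_im]; exact (neg_lt_zero.mpr ht).ne
    have hfix := hF (F.symm τ)
    rw [F.apply_symm_apply, ← htτ] at hfix
    change _ = _ + _ * G t at hfix
    have hfix' := congrArg conj hfix
    rw [map_add, map_mul, Complex.conj_ofReal, Complex.conj_ofReal, ← hGconj] at hfix'
    have hD : G t - G (conj t) ≠ 0 := by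
      rw [hGconj]
      intro h
      have h1 := congrArg Complex.im h
      rw [Complex.sub_im, Complex.conj_im, Complex.zero_im] at h1
      linarith [hGpos t ht]
    generalize (F.symm τ).1.1 = χ at hfix hfix' ⊢
    generalize (F.symm τ).1.2 = κ at hfix hfix' ⊢
    push_cast at hfix hfix'
  · subst hi
    have e1 : G t = _ := slopeFun_activeIndices_zero hI x₁ I₂ y ht.ne'
    have e2 : G (conj t) = _ := slopeFun_activeIndices_zero hI x₁ I₂ y ht'
    rw [e1] at hfix hD
    rw [e2] at hfix' hD
    generalize funP (intervalMeasure T α β) x₁ I₂ y t = P at *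
    generalize funP (intervalMeasure T α β) x₁ I₂ y (conj t) = P' at *
    generalize funQ (intervalMeasure T α β) t = Q at *
    generalize funQ (intervalMeasure T α β) (conj t) = Q' at *
    generalize conj t = t' at *
    have hD' : P - P' - Q + Q' ≠ 0 := by
      intro h
      apply hD
      linear_combination -h
    have hκ : (κ : ℂ) = (t' - t) / (P - P' - Q + Q') := by
      rw [eq_div_iff hD']
      linear_combination hfix - hfix'
    refine ⟨hD', ?_, hκ⟩
    rw [eq_div_iff (mul_ne_zero hnC hD')]
    simp only [Fin.val_zero, CharP.cast_eq_zero, zero_add] at hfix hfix'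
    linear_combination ((n : ℂ) - 1 - P + Q) * hfix' - ((n : ℂ) - 1 - P' + Q') * hfix
  · have e1 : G t = _ := slopeFun_activeIndices_of_ne_zero hI x₁ I₂ y hi ht.ne'
    have e2 : G (conj t) = _ := slopeFun_activeIndices_of_ne_zero hI x₁ I₂ y hi ht'
    rw [e1] at hfix hD
    rw [e2] at hfix' hD
    generalize funQ (intervalMeasure T α β) t = Q at *
    generalize funQ (intervalMeasure T α β) (conj t) = Q' at *
    generalize conj t = t' at *
    refine ⟨hD, ?_, ?_⟩
    · rw [eq_div_iff (mul_ne_zero hnC hD)]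
      linear_combination ((n : ℂ) - ((i : ℕ) + 1) + Q') * hfix -
        ((n : ℂ) - ((i : ℕ) + 1) + Q) * hfix'
    · have hD' : -Q + Q' ≠ 0 := by
        intro h
        apply hD
        linear_combination -h
      rw [eq_div_iff hD']
      linear_combination hfix - hfix'

end FrozenRegion

/-! ### Weight classes are blocks of consecutive positions -/

section Blocks

variable {n M N : ℕ} [NeZero n]

lemma card_weightClass_mem (hN : N = M * n) (σ : Equiv.Perm (Fin N)) (P : Finset (Fin n)) :
    (Finset.univ.filter fun j : Fin N => weightClass n (σ j) ∈ P).card = M * P.card := by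
  subst hN
  have h : ((Finset.univ : Finset (Fin M)) ×ˢ P).card =
      (Finset.univ.filter fun j : Fin (M * n) => weightClass n (σ j) ∈ P).card := by
    refine Finset.card_equiv (finProdFinEquiv.trans σ.symm) fun q => ?_
    have : weightClass n (finProdFinEquiv q) = q.2 := by
      apply Fin.ext
      simp [weightClass, Fin.ofNat, Nat.mod_eq_of_lt q.2.isLt]
    simp [this]
  rw [← h, Finset.card_product, Finset.card_univ, Fintype.card_fin]

/-- The class is monotone along the sorted order and every class has exactly `M` members; counting
the members of smaller classes, with and without the class of `j`, confines `j` to one block. -/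
lemma weightClass_apply_eq_div {x₁ : ℝ} {w : Fin n → ℝ} {σ : Equiv.Perm (Fin N)}
    (hw : IsOrderedWeights x₁ N w σ) (hN : N = M * n) (j : Fin N) :
    (weightClass n (σ j) : ℕ) = (j : ℕ) / M := by
  have hmono : ∀ k l : Fin N, k ≤ l → weightClass n (σ k) ≤ weightClass n (σ l) := by
    intro k l hkl
    by_contra! h
    exact absurd (hw.sorted hkl) (not_le.mpr (hw.strictAnti h))
  have h1 := card_weightClass_mem hN σ (Finset.Iio (weightClass n (σ j)))
  have h2 := card_weightClass_mem hN σ (Finset.Iic (weightClass n (σ j)))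
  rw [Fin.card_Iio] at h1
  rw [Fin.card_Iic] at h2
  have h3 : (Finset.univ.filter fun k : Fin N =>
      weightClass n (σ k) ∈ Finset.Iio (weightClass n (σ j))) ⊆ Finset.Iio j := by
    intro k hk
    simp only [Finset.mem_filter, Finset.mem_univ, true_and, Finset.mem_Iio] at hk ⊢
    by_contra! h
    exact absurd (hmono _ _ h) (not_le.mpr hk)
  have h4 : Finset.Iic j ⊆ (Finset.univ.filter fun k : Fin N =>
      weightClass n (σ k) ∈ Finset.Iic (weightClass n (σ j))) := by
    intro k hk
    simp only [Finset.mem_filter, Finset.mem_univ, true_and, Finset.mem_Iic] at hk ⊢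
    exact hmono _ _ hk
  have h5 := Finset.card_le_card h3
  have h6 := Finset.card_le_card h4
  rw [h1, Fin.card_Iio] at h5
  rw [h2, Fin.card_Iic] at h6
  symm
  apply Nat.div_eq_of_lt_le
  · rw [mul_comm]; exact h5
  · rw [mul_comm]; exact h6

/-- The `j`-th position of the `i`-th block of `M` positions among `M * n` positions. -/
def blockPos (hN : N = M * n) (i : Fin n) (j : Fin M) : Fin N :=
  ⟨i * M + j, by
    have h1 : (i : ℕ) + 1 ≤ n := i.isLt
    calc (i : ℕ) * M + j < i * M + M := by have := j.isLt; omega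
      _ = (i + 1) * M := by ring
      _ ≤ n * M := Nat.mul_le_mul_right _ h1
      _ = N := by rw [hN, mul_comm]⟩

omit [NeZero n] in
lemma blockPos_injective (hN : N = M * n) (i : Fin n) : Function.Injective (blockPos hN i) := by
  intro j k h
  have := congrArg Fin.val h
  simp only [blockPos] at this
  exact Fin.ext (by omega)

omit [NeZero n] in
lemma blockPos_div (hN : N = M * n) (i : Fin n) (j : Fin M) : (blockPos hN i j : ℕ) / M = i := by
  apply Nat.div_eq_of_lt_le
  · simp [blockPos]
  · simp only [blockPos]
    rw [add_mul, one_mul]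
    have := j.isLt
    omega

omit [NeZero n] in
lemma image_blockPos (hN : N = M * n) (i : Fin n) :
    Finset.univ.image (blockPos hN i) =
      Finset.univ.filter fun j : Fin N => (j : ℕ) / M = (i : ℕ) := by
  ext j
  simp only [Finset.mem_image, Finset.mem_univ, true_and, Finset.mem_filter]
  constructor
  · rintro ⟨k, rfl⟩
    exact blockPos_div hN i k
  · intro h
    have hM : 0 < M := by
      rcases Nat.eq_zero_or_pos M with rfl | h
      · exact absurd j.isLt (by simp [hN])
      · exact h
    refine ⟨⟨j % M, Nat.mod_lt _ hM⟩, Fin.ext ?_⟩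
    simp only [blockPos]
    rw [← h]
    exact Nat.div_add_mod' _ _

/-- The later positions of different weight are exactly those beyond the end of the block. -/
lemma eta_blockPos {x₁ : ℝ} {w : Fin n → ℝ} {σ : Equiv.Perm (Fin N)}
    (hw : IsOrderedWeights x₁ N w σ) (hN : N = M * n) (i : Fin n) (j : Fin M) :
    eta (periodicWeights w N) σ (blockPos hN i j) = N - (i + 1) * M := by
  have hM : 0 < M := j.pos
  have hle : ((i : ℕ) + 1) * M ≤ N := by
    rw [hN, mul_comm]
    exact Nat.mul_le_mul_left _ i.isLt
  have h : (Finset.univ.filter fun k : Fin N => blockPos hN i j < k ∧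
      periodicWeights w N (σ k) ≠ periodicWeights w N (σ (blockPos hN i j))) =
      Finset.univ.filter fun k : Fin N => (i + 1) * M ≤ (k : ℕ) := by
    ext k
    rw [Finset.mem_filter, Finset.mem_filter, periodicWeights, periodicWeights]
    simp only [Finset.mem_univ, true_and]
    rw [hw.strictAnti.injective.ne_iff, Ne, Fin.ext_iff, weightClass_apply_eq_div hw hN,
      weightClass_apply_eq_div hw hN, blockPos_div, Fin.lt_def]
    have hj := j.isLt
    have hi : (i + 1) * M = i * M + M := by ring
    constructor
    · rintro ⟨h1, h2⟩
      have h3 : (i : ℕ) ≤ (k : ℕ) / M := by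
        rw [Nat.le_div_iff_mul_le hM]
        simp only [blockPos] at h1
        omega
      rw [← Nat.le_div_iff_mul_le hM]
      omega
    · intro h1
      refine ⟨?_, ?_⟩
      · simp only [blockPos]
        omega
      · rw [← Nat.le_div_iff_mul_le hM] at h1
        omega
  rw [eta, h]
  have h2 : (Finset.univ.filter fun k : Fin N => (i + 1) * M ≤ (k : ℕ)).map Fin.valEmbedding =
      Finset.Ico ((i + 1) * M) N := by
    ext k
    simp only [Finset.mem_map, Finset.mem_filter, Finset.mem_univ, true_and, Fin.valEmbedding_apply,
      Finset.mem_Ico]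
    constructor
    · rintro ⟨l, h3, rfl⟩
      exact ⟨h3, l.isLt⟩
    · rintro ⟨h3, h4⟩
      exact ⟨⟨k, h4⟩, h3, rfl⟩
  rw [← Finset.card_map Fin.valEmbedding, h2, Nat.card_Ico]

lemma phi_eq_ofFn {x₁ : ℝ} {w : Fin n → ℝ} {σ : Equiv.Perm (Fin N)}
    (hw : IsOrderedWeights x₁ N w σ) (hN : N = M * n) {lam : Fin N → ℕ} (hlam : Antitone lam)
    (i : Fin n) :
    phi lam (periodicWeights w N) σ (w i) =
      List.ofFn fun j : Fin M => lam (blockPos hN i j) + (N - (i + 1) * M) := by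
  have hfilter : (Finset.univ.filter fun j : Fin N => periodicWeights w N (σ j) = w i) =
      Finset.univ.map ⟨blockPos hN i, blockPos_injective hN i⟩ := by
    rw [Finset.map_eq_image]
    refine Eq.trans ?_ (image_blockPos hN i).symm
    refine Finset.filter_congr fun j _ => ?_
    rw [periodicWeights, hw.strictAnti.injective.eq_iff, Fin.ext_iff,
      weightClass_apply_eq_div hw hN]
  refine List.Perm.eq_of_pairwise (le := (· ≥ ·)) (fun a b _ _ h1 h2 => le_antisymm h2 h1)
    (Multiset.pairwise_sort _ _) ?_ ?_
  · rw [List.pairwise_ofFn]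
    intro j k hjk
    refine Nat.add_le_add_right (hlam ?_) _
    rw [Fin.le_def]
    simp only [blockPos]
    have := Fin.lt_def.mp hjk
    omega
  · rw [← Multiset.coe_eq_coe, phi, Multiset.sort_eq, hfilter, Finset.map_val, Multiset.map_map,
      List.ofFn_eq_map, ← Multiset.map_coe]
    refine Multiset.map_congr rfl fun j _ => ?_
    simp only [Function.comp_apply, Function.Embedding.coeFn_mk]
    rw [eta_blockPos hw hN]

lemma integral_countingMeasure_ofFn (g : Fin M → ℕ) (f : ℝ → ℝ) :
    ∫ u, f u ∂(countingMeasure (List.ofFn g)) =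
      (M : ℝ)⁻¹ * ∑ j : Fin M, f (((g j : ℝ) + M - ((j : ℝ) + 1)) / M) := by
  have hlen : (List.ofFn g).length = M := List.length_ofFn
  rw [countingMeasure, integral_smul_measure, integral_finsetSum_measure
    (fun j _ => integrable_dirac (by simp))]
  simp only [integral_dirac, smul_eq_mul, ENNReal.toReal_inv, ENNReal.toReal_natCast]
  rw [show ((List.ofFn g).length : ℝ) = M by rw [hlen]]
  congr 1
  refine Fintype.sum_equiv (finCongr hlen) _ _ fun j => ?_
  rw [List.get_ofFn]
  rfl

/-- The position `Ω` of the `j`-th vertex of the boundary. -/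
def position (lam : Fin N → ℕ) (j : Fin N) : ℕ := lam j + (N - (j : ℕ))

/-- The shift by `eta` compensates the offset of the block: the numerator of each atom is the
position in the whole boundary minus one. -/
lemma integral_countingMeasure_phi {x₁ : ℝ} {w : Fin n → ℝ} {σ : Equiv.Perm (Fin N)}
    (hw : IsOrderedWeights x₁ N w σ) (hN : N = M * n) {lam : Fin N → ℕ} (hlam : Antitone lam)
    (i : Fin n) (f : ℝ → ℝ) :
    ∫ u, f u ∂(countingMeasure (phi lam (periodicWeights w N) σ (w i))) =
      (M : ℝ)⁻¹ * ∑ j ∈ Finset.univ.filter (fun j : Fin N => (j : ℕ) / M = (i : ℕ)),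
        f (((position lam j : ℝ) - 1) / M) := by
  have hle : ((i : ℕ) + 1) * M ≤ N := by
    rw [hN, mul_comm]
    exact Nat.mul_le_mul_left _ i.isLt
  rw [phi_eq_ofFn hw hN hlam, integral_countingMeasure_ofFn, ← image_blockPos hN,
    Finset.sum_image fun j _ k _ h => blockPos_injective hN i h]
  congr 1
  refine Finset.sum_congr rfl fun j _ => ?_
  congr 2
  have h1 := (blockPos hN i j).isLt
  rw [position]
  push_cast [Nat.cast_sub hle, Nat.cast_sub h1.le]
  simp only [blockPos]
  push_cast
  ring

end Blocks

/-! ### Segments of the boundary and weight classes -/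

section Segments

variable {n s M N : ℕ} [NeZero n] {lam : Fin N → ℕ} {A B mu : Fin s → ℕ}

lemma position_strictAnti (hlam : Antitone lam) : StrictAnti (position lam) := by
  intro j k hjk
  have h1 := hlam hjk.le
  have h2 := Fin.lt_def.mp hjk
  have h3 := k.isLt
  simp only [position]
  omega

lemma position_add_le (hlam : Antitone lam) {j k : Fin N} (hjk : j ≤ k) :
    position lam k + ((k : ℕ) - (j : ℕ)) ≤ position lam j := by
  have h1 := hlam hjk
  have h2 := Fin.le_def.mp hjk
  have h3 := k.isLt
  simp only [position]
  omega

variable (hb : IsPiecewiseBoundary N lam A B mu)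
include hb

lemma exists_position_eq {t : Fin s} {x : ℕ} (hx : x ∈ Finset.Icc (A t) (B t)) :
    ∃ j, position lam j = x := by
  have h : x ∈ Finset.univ.biUnion (fun t : Fin s => Finset.Icc (A t) (B t)) :=
    Finset.mem_biUnion.mpr ⟨t, Finset.mem_univ _, hx⟩
  rw [← hb.positions, Finset.mem_image] at h
  obtain ⟨j, -, hj⟩ := h
  exact ⟨j, hj⟩

lemma exists_segment (j : Fin N) : ∃ t, position lam j ∈ Finset.Icc (A t) (B t) := by
  have h : position lam j ∈ Finset.univ.image (fun j : Fin N => lam j + (N - (j : ℕ))) :=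
    Finset.mem_image.mpr ⟨j, Finset.mem_univ _, rfl⟩
  rw [hb.positions, Finset.mem_biUnion] at h
  obtain ⟨t, -, ht⟩ := h
  exact ⟨t, ht⟩

lemma segment_unique {t t' : Fin s} {x : ℕ} (h : x ∈ Finset.Icc (A t) (B t))
    (h' : x ∈ Finset.Icc (A t') (B t')) : t = t' := by
  rw [Finset.mem_Icc] at h h'
  by_contra hne
  rcases lt_or_gt_of_ne hne with h1 | h1
  · have := hb.lt _ _ h1; omega
  · have := hb.lt _ _ h1; omega

/-- Positions fill a segment without gaps, so they drop by exactly one at each step, which leaves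
`lam` constant. -/
lemma eq_of_mem_segment {t : Fin s} {j k : Fin N}
    (hj : position lam j ∈ Finset.Icc (A t) (B t)) (hk : position lam k ∈ Finset.Icc (A t) (B t)) :
    lam j = lam k := by
  wlog hjk : j ≤ k generalizing j k
  · exact (this hk hj (le_of_not_ge hjk)).symm
  have hanti := position_strictAnti hb.antitone
  have hsub : Finset.Icc (position lam k) (position lam j) ⊆
      (Finset.Icc j k).image (position lam) := by
    intro x hx
    rw [Finset.mem_Icc] at hx hj hk
    obtain ⟨l, rfl⟩ := exists_position_eq hb (t := t) (x := x) (Finset.mem_Icc.mpr ⟨by omega, by omega⟩)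
    exact Finset.mem_image_of_mem _
      (Finset.mem_Icc.mpr ⟨hanti.le_iff_ge.mp hx.2, hanti.le_iff_ge.mp hx.1⟩)
  have hcard := (Finset.card_le_card hsub).trans Finset.card_image_le
  rw [Nat.card_Icc, Fin.card_Icc] at hcard
  refine le_antisymm ?_ (hb.antitone hjk)
  have h2 := Fin.le_def.mp hjk
  have h3 := k.isLt
  simp only [position] at hcard
  omega

/-- Every segment of the boundary lies in a single weight class. -/
lemma exists_segmentClass [NeZero s] {x₁ : ℝ} {w : Fin n → ℝ} {σ : Equiv.Perm (Fin N)}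
    (hw : IsOrderedWeights x₁ N w σ) (hN : N = M * n) (hM : 0 < M)
    (hJ : ∀ i j : Fin n, i < j → ∀ l ∈ valueIndices lam σ mu i, ∀ t ∈ valueIndices lam σ mu j, l < t) :
    ∃ c : Fin s → Fin n, Antitone c ∧
      (∀ (i : Fin n) (F : ℕ → ℝ),
        ∑ j ∈ Finset.univ.filter (fun j : Fin N => (j : ℕ) / M = (i : ℕ)), F (position lam j) =
          ∑ t ∈ Finset.univ.filter (fun t => c t = i), ∑ x ∈ Finset.Icc (A t) (B t), F x) ∧
      (∀ t, A 0 + (N - (c t + 1) * M) ≤ A t) ∧ (∀ t, B t + c t * M ≤ B (Fin.rev 0)) ∧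
      ∀ i, 2 ≤ (valueIndices lam σ mu i).ncard → 2 ≤ (Finset.univ.filter fun t => c t = i).card := by
  have hanti := position_strictAnti hb.antitone
  have hdiv := weightClass_apply_eq_div hw hN
  -- A segment carries a single value `mu u`. If it met two classes, `u` would belong to both index
  -- sets and `hJ` would give `u < u`.
  have hclass : ∀ t : Fin s, ∀ j k : Fin N, position lam j ∈ Finset.Icc (A t) (B t) →
      position lam k ∈ Finset.Icc (A t) (B t) → weightClass n (σ j) = weightClass n (σ k) := by
    intro t
    have aux : ∀ j k : Fin N, position lam j ∈ Finset.Icc (A t) (B t) →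
        position lam k ∈ Finset.Icc (A t) (B t) → ¬ weightClass n (σ j) < weightClass n (σ k) := by
      intro j k hj hk hlt
      have heq := eq_of_mem_segment hb hj hk
      have hmem : lam j ∈ Set.range mu := by
        rw [hb.mu_range]
        exact Set.mem_range_self j
      obtain ⟨u, hu⟩ := hmem
      exact lt_irrefl u (hJ _ _ hlt u ⟨j, rfl, hu.symm⟩ u ⟨k, rfl, by rw [← heq, hu]⟩)
    intro j k hj hk
    exact le_antisymm (not_lt.mp (aux k j hk hj)) (not_lt.mp (aux j k hj hk))
  choose p hp using fun t : Fin s =>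
    exists_position_eq hb (Finset.mem_Icc.mpr ⟨le_refl (A t), hb.le t⟩)
  choose q hq using fun t : Fin s =>
    exists_position_eq hb (Finset.mem_Icc.mpr ⟨hb.le t, le_refl (B t)⟩)
  have hpmem : ∀ t, position lam (p t) ∈ Finset.Icc (A t) (B t) := fun t => by
    rw [hp]; exact Finset.mem_Icc.mpr ⟨le_rfl, hb.le t⟩
  have hqmem : ∀ t, position lam (q t) ∈ Finset.Icc (A t) (B t) := fun t => by
    rw [hq]; exact Finset.mem_Icc.mpr ⟨hb.le t, le_rfl⟩
  have hpdiv : ∀ t, (weightClass n (σ (p t)) : ℕ) = (p t : ℕ) / M := fun t => hdiv _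
  refine ⟨fun t => weightClass n (σ (p t)), ?_, ?_, ?_, ?_, ?_⟩
  · intro t t' htt
    rw [Fin.le_def, hpdiv, hpdiv]
    refine Nat.div_le_div_right (Fin.le_def.mp (hanti.le_iff_ge.mp ?_))
    rw [hp, hp]
    rcases htt.eq_or_lt with h | h
    · rw [h]
    · exact (hb.le t).trans (hb.lt _ _ h).le
  · intro i F
    rw [← Finset.sum_biUnion]
    · rw [← Finset.sum_image (f := F) (g := position lam) fun j _ k _ h => hanti.injective h]
      congr 1
      ext x
      simp only [Finset.mem_image, Finset.mem_filter, Finset.mem_univ, true_and, Finset.mem_biUnion]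
      constructor
      · rintro ⟨j, hj, rfl⟩
        obtain ⟨t, ht⟩ := exists_segment hb j
        refine ⟨t, ?_, ht⟩
        rw [hclass t _ _ (hpmem t) ht]
        exact Fin.ext ((hdiv j).trans hj)
      · rintro ⟨t, ht, hx⟩
        obtain ⟨j, rfl⟩ := exists_position_eq hb hx
        refine ⟨j, ?_, rfl⟩
        rw [← hdiv j, ← hclass t _ _ (hpmem t) hx, ht]
    · intro t _ t' _ htt
      rw [Function.onFun, Finset.disjoint_left]
      intro x hx hx'
      exact htt (segment_unique hb hx hx')
  -- At least `N - (c t + 1) * M` indices follow `p t`, namely those of the later blocks, and the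
  -- position drops by at least one at each, ending at or above `A 0`.
  · intro t
    have hlt := (p t).isLt
    let last : Fin N := ⟨N - 1, by omega⟩
    have h1 : A 0 ≤ position lam last := by
      obtain ⟨u, hu⟩ := exists_segment hb last
      refine le_trans ?_ (Finset.mem_Icc.mp hu).1
      rcases eq_or_ne u 0 with h | h
      · rw [h]
      · exact (hb.le 0).trans (hb.lt _ _ (Fin.pos_iff_ne_zero.mpr h)).le
    have h2 := position_add_le hb.antitone (j := p t) (k := last)
      (Fin.le_def.mpr (Nat.le_sub_one_of_lt hlt))
    have h3 : (p t : ℕ) < ((p t : ℕ) / M + 1) * M := by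
      rw [mul_comm]
      exact Nat.lt_mul_div_succ _ hM
    rw [hp] at h2
    have h4 : (last : ℕ) = N - 1 := rfl
    rw [h4] at h2
    rw [hpdiv]
    omega
  · intro t
    let first : Fin N := ⟨0, (q t).pos⟩
    have h1 : position lam first ≤ B (Fin.rev 0) := by
      obtain ⟨u, hu⟩ := exists_segment hb first
      refine (Finset.mem_Icc.mp hu).2.trans ?_
      have hle : u ≤ Fin.rev 0 := Fin.le_rev_iff.mpr (Fin.zero_le _)
      rcases hle.eq_or_lt with h | h
      · rw [h]
      · exact (hb.lt _ _ h).le.trans (hb.le _)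
    have h2 := position_add_le hb.antitone (j := first) (k := q t) (Fin.le_def.mpr (Nat.zero_le _))
    have h3 : (q t : ℕ) / M * M ≤ q t := Nat.div_mul_le_self _ _
    rw [hq] at h2
    have h4 : (first : ℕ) = 0 := rfl
    rw [h4] at h2
    have h5 : (weightClass n (σ (p t)) : ℕ) = (q t : ℕ) / M := by
      rw [hclass t _ _ (hpmem t) (hqmem t), hdiv]
    rw [h5]
    omega
  · intro i hi
    obtain ⟨u, u', ⟨j, hj, hju⟩, ⟨k, hk, hku⟩, huu⟩ :=
      (Set.one_lt_ncard_iff (Set.toFinite _)).mp (Nat.lt_of_succ_le hi)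
    obtain ⟨t, ht⟩ := exists_segment hb j
    obtain ⟨t', ht'⟩ := exists_segment hb k
    refine Finset.one_lt_card.mpr ⟨t, ?_, t', ?_, ?_⟩
    · rw [Finset.mem_filter]
      exact ⟨Finset.mem_univ _, (hclass t _ _ (hpmem t) ht).trans hj⟩
    · rw [Finset.mem_filter]
      exact ⟨Finset.mem_univ _, (hclass t' _ _ (hpmem t') ht').trans hk⟩
    · rintro rfl
      exact huu (hb.mu_strictAnti.injective (by rw [← hju, ← hku, eq_of_mem_segment hb ht ht']))

end Segments

/-! ### Riemann sums over integer segments -/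

section RiemannSums

/-- The sample points are the left ends of cells of length `1 / M` that tile `[(A - 1) / M, B / M]`
exactly. -/
lemma abs_riemannSum_sub_integral_le {f : ℝ → ℝ} (hf : Continuous f) {M A B : ℕ} (hM : 0 < M)
    (hAB : A ≤ B) {ε : ℝ}
    (hε : ∀ u ∈ Set.Icc (((A : ℝ) - 1) / M) ((B : ℝ) / M), ∀ v ∈ Set.Icc (((A : ℝ) - 1) / M) ((B : ℝ) / M),
      |u - v| ≤ (M : ℝ)⁻¹ → |f u - f v| ≤ ε) :
    |(M : ℝ)⁻¹ * ∑ x ∈ Finset.Icc A B, f (((x : ℝ) - 1) / M) -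
      ∫ u in (((A : ℝ) - 1) / M)..((B : ℝ) / M), f u| ≤ ε * ((B : ℝ) / M - ((A : ℝ) - 1) / M) := by
  have hM' : (0 : ℝ) < M := Nat.cast_pos.mpr hM
  have hint : ∀ a b : ℝ, IntervalIntegrable f volume a b := fun a b => hf.intervalIntegrable a b
  set g : ℕ → ℝ := fun k => ((k : ℝ) - 1) / M with hg
  have hgsub : ∀ k, g (k + 1) - g k = (M : ℝ)⁻¹ := fun k => by
    simp only [hg]; push_cast; field_simp; ring
  have hgmono : Monotone g := monotone_nat_of_le_succ fun k => by
    have := hgsub k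
    have := inv_pos.mpr hM'
    linarith
  have hend : g (B + 1) = (B : ℝ) / M := by simp [hg]
  have hIco : Finset.Icc A B = Finset.Ico A (B + 1) := by
    ext x
    simp only [Finset.mem_Icc, Finset.mem_Ico]
    omega
  have htel := intervalIntegral.sum_integral_adjacent_intervals_Ico (f := f) (μ := volume) (a := g)
    (m := A) (n := B + 1) (by omega) fun k _ => hint _ _
  rw [hend] at htel
  have htel2 : ∑ k ∈ Finset.Ico A (B + 1), (g (k + 1) - g k) = g (B + 1) - g A :=
    Finset.sum_Ico_sub g (by omega)
  rw [hend] at htel2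
  change |_ - ∫ u in g A..((B : ℝ) / M), f u| ≤ ε * ((B : ℝ) / M - g A)
  rw [← htel, ← htel2, hIco, Finset.mul_sum, Finset.mul_sum, ← Finset.sum_sub_distrib]
  refine (Finset.abs_sum_le_sum_abs _ _).trans (Finset.sum_le_sum fun k hk => ?_)
  rw [Finset.mem_Ico] at hk
  have hk1 : g A ≤ g k := hgmono hk.1
  have hk2 : g (k + 1) ≤ g (B + 1) := hgmono hk.2
  have hk3 : g k ≤ g (k + 1) := hgmono (Nat.le_succ k)
  rw [hend] at hk2
  have e : (M : ℝ)⁻¹ * f (g k) - ∫ u in g k..g (k + 1), f u =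
      ∫ u in g k..g (k + 1), (f (g k) - f u) := by
    rw [intervalIntegral.integral_sub intervalIntegrable_const (hint _ _),
      intervalIntegral.integral_const, hgsub, smul_eq_mul]
  change |(M : ℝ)⁻¹ * f (g k) - _| ≤ _
  rw [e, ← Real.norm_eq_abs, ← abs_of_nonneg (sub_nonneg.mpr hk3)]
  refine intervalIntegral.norm_integral_le_of_norm_le_const fun u hu => ?_
  rw [Set.uIoc_of_le hk3] at hu
  rw [Real.norm_eq_abs]
  have hs := hgsub k
  refine hε _ ⟨hk1, hk3.trans hk2⟩ _ ⟨hk1.trans hu.1.le, hu.2.trans hk2⟩ ?_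
  rw [abs_sub_comm, abs_of_nonneg (by linarith [hu.1])]
  linarith [hu.2]

lemma tendsto_riemannSum {L : Filter ℕ} {M A B : ℕ → ℕ} (hM : Tendsto M L atTop)
    (hAB : ∀ᶠ N in L, A N ≤ B N) {α β : ℝ} (hαβ : α ≤ β)
    (hA : Tendsto (fun N => (A N : ℝ) / M N) L (𝓝 α))
    (hB : Tendsto (fun N => (B N : ℝ) / M N) L (𝓝 β)) {f : ℝ → ℝ} (hf : Continuous f) :
    Tendsto (fun N => (M N : ℝ)⁻¹ * ∑ x ∈ Finset.Icc (A N) (B N), f (((x : ℝ) - 1) / M N)) L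
      (𝓝 (∫ u in Set.Icc α β, f u)) := by
  have hint : ∀ a b : ℝ, IntervalIntegrable f volume a b := fun a b => hf.intervalIntegrable a b
  have hinv : Tendsto (fun N => (M N : ℝ)⁻¹) L (𝓝 0) :=
    tendsto_inv_atTop_zero.comp (tendsto_natCast_atTop_atTop.comp hM)
  have hA' : Tendsto (fun N => ((A N : ℝ) - 1) / M N) L (𝓝 α) := by
    have := hA.sub hinv
    rw [sub_zero] at this
    refine this.congr fun N => ?_
    rw [sub_div, one_div]
  have hI : Tendsto (fun N => ∫ u in (((A N : ℝ) - 1) / M N)..((B N : ℝ) / M N), f u) L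
      (𝓝 (∫ u in Set.Icc α β, f u)) := by
    have hc := intervalIntegral.continuous_primitive (μ := volume) hint 0
    have h := ((hc.tendsto β).comp hB).sub ((hc.tendsto α).comp hA')
    rw [intervalIntegral.integral_interval_sub_left (hint _ _) (hint _ _),
      intervalIntegral.integral_of_le hαβ, ← integral_Icc_eq_integral_Ioc] at h
    refine h.congr fun N => ?_
    exact intervalIntegral.integral_interval_sub_left (hint _ _) (hint _ _)
  have hdiff : Tendsto (fun N =>
      (M N : ℝ)⁻¹ * ∑ x ∈ Finset.Icc (A N) (B N), f (((x : ℝ) - 1) / M N) -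
        ∫ u in (((A N : ℝ) - 1) / M N)..((B N : ℝ) / M N), f u) L (𝓝 0) := by
    rw [Metric.tendsto_nhds]
    intro ε hε
    -- The summation interval eventually lies in `[α - 1, β + 1]`, so its length is below this
    -- number.
    have hlen : 0 < β - α + 3 := by linarith
    obtain ⟨δ, hδ, huc⟩ := Metric.uniformContinuousOn_iff.mp
      (isCompact_Icc.uniformContinuousOn_of_continuous (hf.continuousOn (s := Set.Icc (α - 1) (β + 1))))
      (ε / (β - α + 3)) (div_pos hε hlen)
    filter_upwards [hAB, hA'.eventually_const_lt (show α - 1 < α by linarith),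
      hB.eventually_lt_const (show β < β + 1 by linarith), hinv.eventually_lt_const hδ,
      hM.eventually_gt_atTop 0] with N h1 h2 h3 h4 h5
    rw [Real.dist_eq, sub_zero]
    refine (abs_riemannSum_sub_integral_le hf h5 h1 (ε := ε / (β - α + 3)) ?_).trans_lt ?_
    · intro u hu v hv huv
      have := huc u ⟨h2.le.trans hu.1, hu.2.trans h3.le⟩ v ⟨h2.le.trans hv.1, hv.2.trans h3.le⟩
        (by rw [Real.dist_eq]; exact huv.trans_lt h4)
      rw [Real.dist_eq] at this
      exact this.le
    · rw [div_mul_eq_mul_div, div_lt_iff₀ hlen]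
      exact mul_lt_mul_of_pos_left (by linarith) hε
  simpa using hdiff.add hI

end RiemannSums

/-! ### Stabilization of the class map -/

section Limits

variable {n s : ℕ} [NeZero n]

instance neBot_multiplesAtTop : (multiplesAtTop n).NeBot := by
  rw [multiplesAtTop, inf_principal_neBot_iff]
  intro U hU
  obtain ⟨a, ha⟩ := mem_atTop_sets.mp hU
  exact ⟨n * a, ha _ (Nat.le_mul_of_pos_left _ (NeZero.pos n)), dvd_mul_right _ _⟩

omit [NeZero n] in
lemma eventually_dvd_multiplesAtTop : ∀ᶠ N in multiplesAtTop n, n ∣ N :=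
  mem_inf_of_right (mem_principal_self _)

lemma tendsto_div_multiplesAtTop : Tendsto (fun N => N / n) (multiplesAtTop n) atTop :=
  (Nat.tendsto_div_const_atTop (NeZero.ne n)).mono_left inf_le_left

lemma tendsto_div_blockLength {A : ℕ → ℕ} {a : ℝ}
    (hA : Tendsto (fun N => (A N : ℝ) / N) (multiplesAtTop n) (𝓝 a)) :
    Tendsto (fun N => (A N : ℝ) / ((N / n : ℕ) : ℝ)) (multiplesAtTop n) (𝓝 (n * a)) := by
  refine (hA.const_mul (n : ℝ)).congr' ?_
  filter_upwards [eventually_dvd_multiplesAtTop] with N hN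
  have hn : (n : ℝ) ≠ 0 := Nat.cast_ne_zero.mpr (NeZero.ne n)
  rw [Nat.cast_div hN hn]
  field_simp

omit [NeZero n] in
/-- The classes of the segments are eventually constant. -/
lemma eventually_eq_of_antitone_of_sum {L : Filter ℕ} [L.NeBot] {P : ℕ → (Fin s → Fin n) → Prop}
    (hP : ∀ᶠ N in L, ∃ c, P N c) {d : Fin s → ℝ} (hd : ∀ t, 0 < d t)
    (hanti : ∀ c, (∃ᶠ N in L, P N c) → Antitone c)
    (hsum : ∀ c, (∃ᶠ N in L, P N c) → ∀ i, ∑ t ∈ Finset.univ.filter (fun t => c t = i), d t = 1) :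
    ∃ c, (∀ᶠ N in L, P N c) ∧ ∃ᶠ N in L, P N c := by
  have hbelow : ∀ c, (∃ᶠ N in L, P N c) → ∀ S : Finset (Fin n),
      ∑ t ∈ Finset.univ.filter (fun t => c t ∈ S), d t = S.card := by
    intro c hc S
    rw [← Finset.sum_fiberwise_of_maps_to (g := c) (t := S) (fun t ht => (Finset.mem_filter.mp ht).2)]
    rw [Finset.card_eq_sum_ones, Nat.cast_sum]
    refine Finset.sum_congr rfl fun i hi => ?_
    rw [Finset.filter_filter, Nat.cast_one, ← hsum c hc i]
    refine Finset.sum_congr (Finset.filter_congr fun t _ => ?_) fun _ _ => rfl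
    constructor
    · exact fun h => h.2
    · exact fun h => ⟨h ▸ hi, h⟩
  -- Each class has mass one, so the masses determine an antitone class map. If `c t < c' t`, the
  -- segments from `t` on have mass at most `c t + 1` by `c`, while those strictly after `t` have
  -- mass at least `c' t ≥ c t + 1` by `c'`, against `0 < d t`.
  have hle : ∀ c c', (∃ᶠ N in L, P N c) → (∃ᶠ N in L, P N c') → ∀ t, c' t ≤ c t := by
    intro c c' hc hc' t
    by_contra! hlt
    have h1 := hbelow c hc (Finset.Iic (c t))
    have h2 := hbelow c' hc' (Finset.Iio (c' t))
    rw [Fin.card_Iic] at h1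
    rw [Fin.card_Iio] at h2
    have hsub : Finset.Ici t ⊆ Finset.univ.filter fun u => c u ∈ Finset.Iic (c t) := by
      intro u hu
      rw [Finset.mem_filter, Finset.mem_Iic]
      exact ⟨Finset.mem_univ _, hanti c hc (Finset.mem_Ici.mp hu)⟩
    have hsub' : (Finset.univ.filter fun u => c' u ∈ Finset.Iio (c' t)) ⊆ Finset.Ioi t := by
      intro u hu
      rw [Finset.mem_filter, Finset.mem_Iio] at hu
      rw [Finset.mem_Ioi]
      by_contra! h
      exact absurd (hanti c' hc' h) (not_le.mpr hu.2)
    have h3 := Finset.sum_le_sum_of_subset_of_nonneg (f := d) hsub fun u _ _ => (hd u).le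
    have h4 := Finset.sum_le_sum_of_subset_of_nonneg (f := d) hsub' fun u _ _ => (hd u).le
    have h5 : ∑ u ∈ Finset.Ici t, d u = d t + ∑ u ∈ Finset.Ioi t, d u := by
      rw [← Finset.Ioi_insert, Finset.sum_insert (by simp)]
    have h6 : ((c t : ℕ) : ℝ) + 1 ≤ (c' t : ℕ) := by exact_mod_cast hlt
    rw [h1] at h3
    rw [h2] at h4
    push_cast at h3
    linarith [hd t]
  obtain ⟨c, hc⟩ : ∃ c, ∃ᶠ N in L, P N c := by
    by_contra! h
    have h1 : ∀ᶠ N in L, ∀ c, ¬ P N c := eventually_all.mpr h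
    obtain ⟨N, h2, c, h3⟩ := (h1.and hP).exists
    exact h2 c h3
  refine ⟨c, ?_, hc⟩
  have h1 : ∀ᶠ N in L, ∀ c', c' ≠ c → ¬ P N c' := by
    refine eventually_all.mpr fun c' => ?_
    by_cases h : c' = c
    · exact Eventually.of_forall fun N hne => absurd h hne
    · have h2 : ¬ ∃ᶠ N in L, P N c' := fun h3 =>
        h (funext fun t => le_antisymm (hle c c' hc h3 t) (hle c' c h3 hc t))
      filter_upwards [not_frequently.mp h2] with N h4 _ using h4
  filter_upwards [h1, hP] with N h2 ⟨c', h3⟩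
  by_cases h : c' = c
  · exact h ▸ h3
  · exact absurd h3 (h2 c' h)

end Limits

/-! ### The limit measures -/

section LimitMeasure

variable {n s : ℕ} [NeZero n]

lemma isProbabilityMeasure_intervalMeasure {ι : Type*} {T : Finset ι} {α β : ι → ℝ}
    (hlt : ∀ k ∈ T, α k < β k) (hsum : ∑ k ∈ T, (β k - α k) = 1) :
    IsProbabilityMeasure (intervalMeasure T α β) := by
  constructor
  rw [intervalMeasure, Measure.finsetSum_apply]
  simp only [Measure.restrict_apply_univ, Real.volume_Icc]
  rw [← ENNReal.ofReal_sum_of_nonneg fun k hk => sub_nonneg.mpr (hlt k hk).le, hsum,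
    ENNReal.ofReal_one]

omit [NeZero n] in
lemma card_filter_div_eq {M N : ℕ} (hN : N = M * n) (i : Fin n) :
    (Finset.univ.filter fun j : Fin N => (j : ℕ) / M = (i : ℕ)).card = M := by
  rw [← image_blockPos hN, Finset.card_image_of_injective _ (blockPos_injective hN i),
    Finset.card_univ, Fintype.card_fin]

/-- The limit of the counting measures of the `i`-th class is Lebesgue measure on a union of the
limits of the segments, and these limits satisfy the bounds forced by the other classes. -/
theorem exists_limit_intervals [NeZero s] {x₁ : ℝ} {w : ℕ → Fin n → ℝ}
    {σ : (N : ℕ) → Equiv.Perm (Fin N)}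
    (hw : ∀ᶠ N in multiplesAtTop n, IsOrderedWeights x₁ N (w N) (σ N))
    {lam : (N : ℕ) → Fin N → ℕ} {A B mu : ℕ → Fin s → ℕ}
    (hlam : ∀ᶠ N in multiplesAtTop n, IsPiecewiseBoundary N (lam N) (A N) (B N) (mu N))
    {a b : Fin s → ℝ} (hab : ∀ t, a t < b t)
    (hA : ∀ t, Tendsto (fun N : ℕ => (A N t : ℝ) / (N : ℝ)) (multiplesAtTop n) (𝓝 (a t)))
    (hB : ∀ t, Tendsto (fun N : ℕ => (B N t : ℝ) / (N : ℝ)) (multiplesAtTop n) (𝓝 (b t)))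
    (hJ : ∀ᶠ N in multiplesAtTop n, ∀ i j : Fin n, i < j →
      ∀ l ∈ valueIndices (lam N) (σ N) (mu N) i, ∀ t ∈ valueIndices (lam N) (σ N) (mu N) j, l < t)
    (i : Fin n) :
    ∃ T : Finset (Fin s), ∑ t ∈ T, ((n : ℝ) * b t - n * a t) = 1 ∧
      (∀ t ∈ T, (n : ℝ) * a 0 + ((n : ℝ) - ((i : ℕ) + 1)) ≤ n * a t) ∧
      (∀ t ∈ T, (n : ℝ) * b t ≤ n * b (Fin.rev 0) - (i : ℕ)) ∧
      ((∀ᶠ N in multiplesAtTop n, 2 ≤ (valueIndices (lam N) (σ N) (mu N) i).ncard) → 2 ≤ T.card) ∧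
      IsWeakLimit (multiplesAtTop n)
        (fun N => countingMeasure (phi (lam N) (periodicWeights (w N) N) (σ N) (w N i)))
        (intervalMeasure T (fun t => n * a t) (fun t => n * b t)) := by
  have hn : (0 : ℝ) < n := Nat.cast_pos.mpr (NeZero.pos n)
  have hM := tendsto_div_multiplesAtTop (n := n)
  have hMN : ∀ᶠ N in multiplesAtTop n, N = N / n * n := by
    filter_upwards [eventually_dvd_multiplesAtTop] with N hN using (Nat.div_mul_cancel hN).symm
  have hM0 := hM.eventually_gt_atTop 0
  have hA' := fun t => tendsto_div_blockLength (hA t)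
  have hB' := fun t => tendsto_div_blockLength (hB t)
  have hinv : Tendsto (fun N => (1 : ℝ) / ((N / n : ℕ) : ℝ)) (multiplesAtTop n) (𝓝 0) := by
    simp only [one_div]
    exact tendsto_inv_atTop_zero.comp (tendsto_natCast_atTop_atTop.comp hM)
  set P : ℕ → (Fin s → Fin n) → Prop := fun N c => Antitone c ∧
      (∀ (i : Fin n) (F : ℕ → ℝ),
        ∑ j ∈ Finset.univ.filter (fun j : Fin N => (j : ℕ) / (N / n) = (i : ℕ)),
            F (position (lam N) j) =
          ∑ t ∈ Finset.univ.filter (fun t => c t = i), ∑ x ∈ Finset.Icc (A N t) (B N t), F x) ∧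
      (∀ t, A N 0 + (N - (c t + 1) * (N / n)) ≤ A N t) ∧
      (∀ t, B N t + c t * (N / n) ≤ B N (Fin.rev 0)) ∧
      ∀ i, 2 ≤ (valueIndices (lam N) (σ N) (mu N) i).ncard →
        2 ≤ (Finset.univ.filter fun t => c t = i).card with hPdef
  have hP : ∀ᶠ N in multiplesAtTop n, ∃ c, P N c := by
    filter_upwards [hw, hlam, hJ, hMN, hM0] with N h1 h2 h3 h4 h5
    exact exists_segmentClass h2 h1 h4 h5 h3
  -- Whenever `c` occurs, the segments of a class contain exactly `N / n` positions in all. The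
  -- summand `1 / (N / n)` accounts for both ends being included, and vanishes in the limit.
  have hsum : ∀ c, (∃ᶠ N in multiplesAtTop n, P N c) → ∀ i,
      ∑ t ∈ Finset.univ.filter (fun t => c t = i), ((n : ℝ) * b t - n * a t) = 1 := by
    intro c hc i
    have h1 : Tendsto (fun N => ∑ t ∈ Finset.univ.filter (fun t => c t = i),
        ((B N t : ℝ) / ((N / n : ℕ) : ℝ) - (A N t : ℝ) / ((N / n : ℕ) : ℝ) +
          1 / ((N / n : ℕ) : ℝ))) (multiplesAtTop n)
        (𝓝 (∑ t ∈ Finset.univ.filter (fun t => c t = i), ((n : ℝ) * b t - n * a t + 0))) :=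
      tendsto_finsetSum _ fun t _ => ((hB' t).sub (hA' t)).add hinv
    simp only [add_zero] at h1
    refine tendsto_nhds_unique_of_frequently_eq h1 tendsto_const_nhds ?_
    refine (hc.and_eventually (hMN.and (hM0.and hlam))).mono ?_
    rintro N ⟨⟨-, h2, -⟩, h3, h4, h5⟩
    have h6 := h2 i fun _ => 1
    rw [← Nat.cast_one, Finset.sum_const, card_filter_div_eq h3] at h6
    have h7 : (0 : ℝ) < ((N / n : ℕ) : ℝ) := Nat.cast_pos.mpr h4
    have h8 : ∀ t ∈ Finset.univ.filter (fun t => c t = i),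
        (B N t : ℝ) / ((N / n : ℕ) : ℝ) - (A N t : ℝ) / ((N / n : ℕ) : ℝ) +
          1 / ((N / n : ℕ) : ℝ) =
        (∑ x ∈ Finset.Icc (A N t) (B N t), ((1 : ℕ) : ℝ)) / ((N / n : ℕ) : ℝ) := by
      intro t _
      rw [Finset.sum_const, Nat.card_Icc, nsmul_eq_mul,
        Nat.cast_sub ((h5.le t).trans (Nat.le_succ _))]
      push_cast
      ring
    rw [Finset.sum_congr rfl h8, ← Finset.sum_div, ← h6]
    simp [h7.ne']
  obtain ⟨c, hc, hcf⟩ := eventually_eq_of_antitone_of_sum hP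
    (d := fun t => (n : ℝ) * b t - n * a t)
    (fun t => sub_pos.mpr (mul_lt_mul_of_pos_left (hab t) hn))
    (fun c hc => hc.exists.choose_spec.1) hsum
  have hTsum := hsum c hcf i
  refine ⟨Finset.univ.filter fun t => c t = i, hTsum, ?_, ?_, ?_, ?_, ?_⟩
  · intro t ht
    have hct : c t = i := (Finset.mem_filter.mp ht).2
    refine le_of_tendsto_of_tendsto ((hA' 0).add_const ((n : ℝ) - ((i : ℕ) + 1))) (hA' t) ?_
    filter_upwards [hc, hMN, hM0] with N h1 h2 h3
    have h4 := h1.2.2.1 t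
    rw [hct] at h4
    have h5 : ((i : ℕ) + 1) * (N / n) ≤ N := by
      conv_rhs => rw [h2, mul_comm]
      exact Nat.mul_le_mul_right _ i.isLt
    have h6 : (0 : ℝ) < ((N / n : ℕ) : ℝ) := Nat.cast_pos.mpr h3
    have h7 : ((A N 0 + (N - (i + 1) * (N / n)) : ℕ) : ℝ) ≤ A N t := Nat.cast_le.mpr h4
    have h8 : (N : ℝ) = ((N / n : ℕ) : ℝ) * n := by exact_mod_cast h2
    rw [Nat.cast_add, Nat.cast_sub h5, h8, Nat.cast_mul] at h7
    rw [le_div_iff₀ h6, add_mul, div_mul_cancel₀ _ h6.ne']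
    push_cast at h7
    linarith
  · intro t ht
    have hct : c t = i := (Finset.mem_filter.mp ht).2
    refine le_of_tendsto_of_tendsto (hB' t) ((hB' (Fin.rev 0)).sub_const ((i : ℕ) : ℝ)) ?_
    filter_upwards [hc, hM0] with N h1 h3
    have h4 := h1.2.2.2.1 t
    rw [hct] at h4
    have h6 : (0 : ℝ) < ((N / n : ℕ) : ℝ) := Nat.cast_pos.mpr h3
    have h7 : ((B N t + i * (N / n) : ℕ) : ℝ) ≤ B N (Fin.rev 0) := Nat.cast_le.mpr h4
    rw [Nat.cast_add, Nat.cast_mul] at h7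
    rw [div_le_iff₀ h6, sub_mul, div_mul_cancel₀ _ h6.ne']
    linarith
  · intro h
    obtain ⟨N, h1, h2⟩ := (h.and hc).exists
    exact h2.2.2.2.2 i h1
  · exact isProbabilityMeasure_intervalMeasure
      (fun t _ => mul_lt_mul_of_pos_left (hab t) hn) hTsum
  · intro f
    rw [integral_intervalMeasure _ _ _ f.continuous]
    have h1 := tendsto_finsetSum (Finset.univ.filter fun t => c t = i) fun t _ =>
      tendsto_riemannSum (A := fun N => A N t) (B := fun N => B N t) hM
        (hlam.mono fun N h => h.le t) (mul_le_mul_of_nonneg_left (hab t).le hn.le) (hA' t) (hB' t)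
        f.continuous
    refine h1.congr' ?_
    filter_upwards [hw, hlam, hc, hMN] with N h2 h3 h4 h5
    rw [integral_countingMeasure_phi h2 h5 h3.antitone,
      h4.2.1 i fun x => f (((x : ℝ) - 1) / ((N / n : ℕ) : ℝ)), Finset.mul_sum]

end LimitMeasure

end SquareHexagon

/-! ### The main theorem -/

open SquareHexagon in
theorem mainTheorem7 {n s : ℕ} [NeZero n] [NeZero s]
    -- edge weights `x_{1,N} = x₁ > ... > x_{n,N} > 0`, and `y_l` for `l ∈ I₂ ∩ {1, ..., n}`
    (x₁ : ℝ) (w : ℕ → Fin n → ℝ) (I₂ : Finset (Fin n)) (y : Fin n → ℝ) (hy : ∀ l ∈ I₂, 0 < y l)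
    (σ : (N : ℕ) → Equiv.Perm (Fin N))
    (hw : ∀ᶠ N in multiplesAtTop n, IsOrderedWeights x₁ N (w N) (σ N))
    -- the piecewise boundary condition
    (lam : (N : ℕ) → Fin N → ℕ) (A B mu : ℕ → Fin s → ℕ)
    (hlam : ∀ᶠ N in multiplesAtTop n, IsPiecewiseBoundary N (lam N) (A N) (B N) (mu N))
    (a b : Fin s → ℝ) (hab : ∀ t, a t < b t) (hba : ∀ t t', t < t' → b t < a t')
    (hA : ∀ t, Tendsto (fun N : ℕ => (A N t : ℝ) / (N : ℝ)) (multiplesAtTop n) (𝓝 (a t)))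
    (hB : ∀ t, Tendsto (fun N : ℕ => (B N t : ℝ) / (N : ℝ)) (multiplesAtTop n) (𝓝 (b t)))
    -- different weight classes see different segments
    (hJ : ∀ᶠ N in multiplesAtTop n, ∀ i j : Fin n, i < j →
      ∀ l ∈ valueIndices (lam N) (σ N) (mu N) i, ∀ t ∈ valueIndices (lam N) (σ N) (mu N) j, l < t)
    (i : Fin n) :
    ∃ m : Measure ℝ,
      IsWeakLimit (multiplesAtTop n)
        (fun N => countingMeasure (phi (lam N) (periodicWeights (w N) N) (σ N) (w N i))) m ∧
      -- the `i`-th class is not completely frozen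
      ((∀ᶠ N in multiplesAtTop n, 2 ≤ (valueIndices (lam N) (σ N) (mu N) i).ncard) ∨
          (i = 0 ∧ I₂.Nonempty) →
      ∃ T : regionS m x₁ I₂ y a b i ≃ₜ UpperHalfPlane,
        (∀ p : regionS m x₁ I₂ y a b i,
          (∃ z : ℂ, z.im < 0 ∧ IsRoot m x₁ I₂ y i p.1.1 p.1.2 z (T p : ℂ)) ∧
          ∀ z t : ℂ, z.im < 0 → IsRoot m x₁ I₂ y i p.1.1 p.1.2 z t → t = (T p : ℂ)) ∧
        (i = 0 → ∀ τ : UpperHalfPlane, ∀ t : ℂ, t = (τ : ℂ) →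
          funP m x₁ I₂ y t - funP m x₁ I₂ y (conj t) - funQ m t + funQ m (conj t) ≠ 0 ∧
          (((T.symm τ).1.1 : ℝ) : ℂ) =
            (conj t * (funP m x₁ I₂ y t - funQ m t)
                - t * (funP m x₁ I₂ y (conj t) - funQ m (conj t)) - ((n : ℂ) - 1) * (conj t - t)) /
              ((n : ℂ) * (funP m x₁ I₂ y t - funP m x₁ I₂ y (conj t)
                - funQ m t + funQ m (conj t))) ∧
          (((T.symm τ).1.2 : ℝ) : ℂ) =
            (conj t - t) /
              (funP m x₁ I₂ y t - funP m x₁ I₂ y (conj t) - funQ m t + funQ m (conj t))) ∧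
        (i ≠ 0 → ∀ τ : UpperHalfPlane, ∀ t : ℂ, t = (τ : ℂ) →
          funQ m t - funQ m (conj t) ≠ 0 ∧
          (((T.symm τ).1.1 : ℝ) : ℂ) =
            (conj t * funQ m t - t * funQ m (conj t)
                + (conj t - t) * ((n : ℂ) - ((i : ℕ) + 1))) /
              ((n : ℂ) * (funQ m t - funQ m (conj t))) ∧
          (((T.symm τ).1.2 : ℝ) : ℂ) = (conj t - t) / (-funQ m t + funQ m (conj t)))) := by
  obtain ⟨T, hsum, ha, hb, hcard, hlim⟩ := exists_limit_intervals hw hlam hab hA hB hJ i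
  have hn : (0 : ℝ) < n := Nat.cast_pos.mpr (NeZero.pos n)
  have hx₁ : 0 < x₁ := by
    obtain ⟨N, hN⟩ := hw.exists
    exact hN.first ▸ hN.pos 0
  have hI : DisjointIntervals T (fun t => (n : ℝ) * a t) (fun t => (n : ℝ) * b t) := by
    refine ⟨fun t _ => mul_lt_mul_of_pos_left (hab t) hn, fun j _ k _ hjk => ?_⟩
    rcases lt_or_gt_of_ne hjk with h | h
    · exact Or.inl (mul_lt_mul_of_pos_left (hba _ _ h) hn)
    · exact Or.inr (mul_lt_mul_of_pos_left (hba _ _ h) hn)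
  exact ⟨_, hlim, fun hne =>
    exists_homeomorph_regionS hI hsum hx₁ hy (hne.imp_left hcard) ha hb rfl⟩
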